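/- Let $p\ge 5$ be a prime, $\zeta_p$ a primitive $p$-th root of unity, $L=\mathbb Q(\zeta_p)$, $\mathcal O=\mathbb Z[\zeta_p]$, $\pi=\zeta_p-1$, $U=1+\pi^2\mathbb Z_p[\zeta_p]$, and $\Delta=\mathrm{Gal}(L/\mathbb Q)$, with $\sigma_{-1}\in\Delta$ the automorphism $\zeta_p\mapsto\zeta_p^{-1}$. Let $\omega:\Delta\to\mathbb Z_p^*$ be the Teichmüller character, $\sigma(\zeta_p)=\zeta_p^{\omega(\sigma)}$. For a character $\psi:\Delta\to\mathbb Z_p^*$ put $e_\psi=\frac1{p-1}\sum_{\delta\in\Delta}\psi^{-1}(\delta)\,\delta\in\mathbb Z_p[\Delta]$ and $M(\psi)=e_\psi M$ for a $\mathbb Z_p[\Delta]$-module $M$. Let $Cl(L)$ be the ideal class group of $L$, let $A$ be its $p$-Sylow subgroup, and let $\mathcal I$ be the group of fractional ideals of $L$ prime to $p$. Let $\mathcal W$ be the set of $\mathbb Z[\Delta]$-homomorphisms $f:\mathcal I\to L^*$ such that $f(\mathcal I)\subset U$ and such that there is $\beta(f)\in\mathbb Z[\Delta]$ with $f(\alpha\mathcal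 O)=\alpha^{\beta(f)}$ for all $\alpha\in L^*\cap U$. Let $\mathcal W^-$ be the set of $f\in\mathcal W$ with $\sigma_{-1}(f(\mathfrak a))=f(\mathfrak a)^{-1}$ for all $\mathfrak a\in\mathcal I$, and let $W\subset L^*$ be the $\mathbb Z[\Delta]$-submodule generated by all values $f(\mathfrak a)$, $f\in\mathcal W$, $\mathfrak a\in\mathcal I$. Let $\psi\ne\omega$ be an odd character, that is, $\psi(\sigma_{-1})=-1$. Let $m\ge 1$ with $p^m>|A|$, let $e_m(\psi)\in\mathbb Z[\Delta]$ satisfy $\sigma_{-1}e_m(\psi)=-e_m(\psi)$ and $e_m(\psi)\equiv e_\psi \pmod{p^m}$, and put $n=|Cl(L)|/|A|$. **Theorem.** The exponent of $A(\psi)$ is a power $p^{k(\psi)}$ of $p$; there is a unique $f_\psi\in\mathcal W^-$ with $f_\psi(\alpha\mathcal O)=\alpha^{2np^{k(\psi)}e_m(\psi)}$ for all $\alpha\in L^*\cap U$; and $f_\psi$ induces an isomorphism of groups $$A(\psi)\;\cong\;\left(\frac{W(L^*)^{p^{k(\psi)}}}{(L^*)^{p^{k(\psi)}}}\right)(\psi),$$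 which sends the class of $\mathfrak a$ to the class of $f_\psi(\mathfrak a)$, for every $\mathfrak a\in\mathcal I$ whose ideal class lies in $A(\psi)$. -/

import Mathlib

open NumberField
open scoped nonZeroDivisors

noncomputable section

namespace JacobiSums

/-! ### Bounded `p`-primary groups as `ℤ_p`-modules, and `ψ`-components -/

section Padic

variable (p : ℕ) [Fact p.Prime]

/-- An abelian group killed by some `p ^ N` is a module over `ℤ_p`, through
`ℤ_p → ℤ / p ^ N`. This is its only `ℤ_p`-module structure; it does not depend on `N`. -/
abbrev padicModule {M : Type*} [AddCommGroup M] (h : ∃ N : ℕ, ∀ x : M, p ^ N • x = 0) :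
    Module ℤ_[p] M :=
  letI : Module (ZMod (p ^ h.choose)) M := AddCommGroup.zmodModule h.choose_spec
  Module.compHom M (PadicInt.toZModPow (p := p) h.choose)

/-- Every additive group action on a `p ^ N`-torsion group is `ℤ_p`-linear. -/
theorem padic_smulCommClass {G M : Type*} [Group G] [AddCommGroup M] [DistribMulAction G M]
    [Module ℤ_[p] M] (h : ∃ N : ℕ, ∀ x : M, p ^ N • x = 0) : SMulCommClass G ℤ_[p] M := by
  obtain ⟨N, hN⟩ := h
  have key : ∀ (c : ℤ_[p]) (x : M), c • x = (c.appr N) • x := by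
    intro c x
    obtain ⟨d, hd⟩ := Ideal.mem_span_singleton'.1 (PadicInt.appr_spec N c)
    have hc : c = (c.appr N : ℤ_[p]) + d * ((p ^ N : ℕ) : ℤ_[p]) := by
      push_cast
      rw [hd]
      ring
    conv_lhs => rw [hc]
    rw [add_smul, mul_smul, Nat.cast_smul_eq_nsmul, Nat.cast_smul_eq_nsmul, hN, smul_zero,
      add_zero]
  refine ⟨fun g c x => ?_⟩
  rw [key, key]
  exact map_nsmul (DistribSMul.toAddMonoidHom M g) _ _

variable {p} {G : Type*} [Group G] [Fintype G]

/-- The element `e_ψ = (p - 1)⁻¹ ∑_δ ψ⁻¹(δ) δ` of `ℤ_p[G]`, for `G` of order `p - 1`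
(`p - 1` is a unit of `ℤ_p`, so `Ring.inverse` is its true inverse). -/
def eIdem (ψ : G →* ℤ_[p]ˣ) : MonoidAlgebra ℤ_[p] G :=
  Ring.inverse ((p : ℤ_[p]) - 1) •
    ∑ δ : G, MonoidAlgebra.single δ (((ψ δ)⁻¹ : ℤ_[p]ˣ) : ℤ_[p])

/-- `N(ψ) = e_ψ N` for a subgroup `N` of the `ℤ_p[G]`-module `M`. -/
def psiPart (ψ : G →* ℤ_[p]ˣ) {M : Type*} [AddCommGroup M] [Module ℤ_[p] M]
    [DistribMulAction G M] [SMulCommClass G ℤ_[p] M] (N : AddSubgroup M) : AddSubgroup M :=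
  N.map (((Representation.ofDistribMulAction ℤ_[p] G M).asAlgebraHom (eIdem ψ)).toAddMonoidHom)

end Padic

/-! ### Galois action on fractional ideals and on the class group -/

section Galois

variable {L : Type*} [Field L] [NumberField L]

/-- The ring automorphism of `𝓞 L` given by `σ ∈ Gal(L/ℚ)`. -/
abbrev galInt (σ : Gal(L/ℚ)) : 𝓞 L ≃+* 𝓞 L := RingOfIntegers.mapRingEquiv σ.toRingEquiv

theorem mem_galFrac (σ : Gal(L/ℚ)) (I : FractionalIdeal (𝓞 L)⁰ L) (x : L) :
    x ∈ FractionalIdeal.ringEquivOfRingEquiv L L (galInt σ) I ↔ ∃ y ∈ I, σ y = x := by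
  have h : ∀ y : L, IsFractionRing.ringEquivOfRingEquiv (K := L) (L := L) (galInt σ) y = σ y := by
    intro y
    obtain ⟨a, b, -, rfl⟩ := IsFractionRing.div_surjective (A := 𝓞 L) y
    rw [map_div₀, map_div₀, IsFractionRing.ringEquivOfRingEquiv_algebraMap,
      IsFractionRing.ringEquivOfRingEquiv_algebraMap]
    rfl
  constructor
  · rintro ⟨y, hy, rfl⟩
    exact ⟨y, hy, (h y).symm⟩
  · rintro ⟨y, hy, rfl⟩
    exact ⟨y, hy, h y⟩

/-- `Gal(L/ℚ)` acts on the group of nonzero fractional ideals, `σ • I = σ(I)`. -/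
instance galFracAction : MulDistribMulAction Gal(L/ℚ) (FractionalIdeal (𝓞 L)⁰ L)ˣ where
  smul σ := Units.map (FractionalIdeal.ringEquivOfRingEquiv L L (galInt σ)).toMonoidHom
  one_smul I := by
    ext x
    refine (mem_galFrac 1 I.1 x).trans ?_
    simp
  mul_smul σ τ I := by
    ext x
    refine (mem_galFrac (σ * τ) I.1 x).trans (Iff.trans ?_ (mem_galFrac σ _ x).symm)
    constructor
    · rintro ⟨y, hy, rfl⟩
      exact ⟨τ y, (mem_galFrac τ I.1 _).2 ⟨y, hy, rfl⟩, rfl⟩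
    · rintro ⟨z, hz, rfl⟩
      obtain ⟨y, hy, rfl⟩ := (mem_galFrac τ I.1 z).1 hz
      exact ⟨y, hy, rfl⟩
  smul_one σ := map_one _
  smul_mul σ I J := map_mul _ I J

/-- The underlying set of `σ • I` is `σ(I)`. -/
theorem mem_galois_smul (σ : Gal(L/ℚ)) (I : (FractionalIdeal (𝓞 L)⁰ L)ˣ) (x : L) :
    x ∈ ((σ • I : (FractionalIdeal (𝓞 L)⁰ L)ˣ) : FractionalIdeal (𝓞 L)⁰ L) ↔
      ∃ y ∈ (I : FractionalIdeal (𝓞 L)⁰ L), σ y = x :=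
  mem_galFrac σ I.1 x

theorem galois_smul_principal (σ : Gal(L/ℚ)) (α : Lˣ) :
    σ • toPrincipalIdeal (𝓞 L) L α = toPrincipalIdeal (𝓞 L) L (σ • α) := by
  ext x
  rw [mem_galois_smul]
  simp only [coe_toPrincipalIdeal, FractionalIdeal.mem_spanSingleton]
  constructor
  · rintro ⟨_, ⟨z, rfl⟩, rfl⟩
    exact ⟨galInt σ z, by simp [Algebra.smul_def, AlgEquiv.smul_units_def]⟩
  · rintro ⟨z, rfl⟩
    refine ⟨_, ⟨(galInt σ).symm z, rfl⟩, ?_⟩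
    simp [Algebra.smul_def, AlgEquiv.smul_units_def]

/-- The map induced by `σ` on ideal classes. -/
def galClassHom (σ : Gal(L/ℚ)) : ClassGroup (𝓞 L) →* ClassGroup (𝓞 L) :=
  (ClassGroup.equiv L).symm.toMonoidHom.comp
    ((QuotientGroup.map _ _ (MulDistribMulAction.toMonoidHom _ σ) (by
      rintro _ ⟨α, rfl⟩
      exact ⟨σ • α, (galois_smul_principal σ α).symm⟩)).comp
        (ClassGroup.equiv L).toMonoidHom)

theorem classGroup_equiv_mk_self (I : (FractionalIdeal (𝓞 L)⁰ L)ˣ) :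
    ClassGroup.equiv L (ClassGroup.mk L I) = QuotientGroup.mk I := by
  rw [ClassGroup.equiv_mk]
  refine congrArg QuotientGroup.mk (Units.ext ?_)
  exact congrArg (fun h => h (I : FractionalIdeal (𝓞 L)⁰ L))
    (FractionalIdeal.canonicalEquiv_self (𝓞 L)⁰ L)

theorem classGroup_mk_surjective (c : ClassGroup (𝓞 L)) :
    ∃ I : (FractionalIdeal (𝓞 L)⁰ L)ˣ, ClassGroup.mk L I = c := by
  obtain ⟨I, hI⟩ := QuotientGroup.mk_surjective (ClassGroup.equiv L c)
  exact ⟨I, (ClassGroup.equiv L).injective ((classGroup_equiv_mk_self I).trans hI)⟩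

theorem galClassHom_mk (σ : Gal(L/ℚ)) (I : (FractionalIdeal (𝓞 L)⁰ L)ˣ) :
    galClassHom σ (ClassGroup.mk L I) = ClassGroup.mk L (σ • I) := by
  apply (ClassGroup.equiv L).injective
  rw [classGroup_equiv_mk_self]
  simp only [galClassHom, MonoidHom.comp_apply, MulEquiv.toMonoidHom_eq_coe, MonoidHom.coe_coe,
    MulEquiv.apply_symm_apply, classGroup_equiv_mk_self]
  rfl

/-- `Gal(L/ℚ)` acts on the ideal class group by `σ • [I] = [σ(I)]`. -/
instance galClassAction : MulDistribMulAction Gal(L/ℚ) (ClassGroup (𝓞 L)) where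
  smul σ c := galClassHom σ c
  one_smul c := by
    obtain ⟨I, rfl⟩ := classGroup_mk_surjective c
    exact (galClassHom_mk 1 I).trans (congrArg _ (one_smul _ I))
  mul_smul σ τ c := by
    obtain ⟨I, rfl⟩ := classGroup_mk_surjective c
    refine (galClassHom_mk (σ * τ) I).trans ?_
    refine Eq.trans ?_ (congrArg (galClassHom σ) (galClassHom_mk τ I).symm)
    exact (congrArg _ (mul_smul σ τ I)).trans (galClassHom_mk σ (τ • I)).symm
  smul_one σ := map_one (galClassHom σ)
  smul_mul σ := map_mul (galClassHom σ)

theorem galois_smul_mk (σ : Gal(L/ℚ)) (I : (FractionalIdeal (𝓞 L)⁰ L)ˣ) :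
    σ • ClassGroup.mk L I = ClassGroup.mk L (σ • I) := galClassHom_mk σ I

end Galois

/-! ### The modules `A` and `L* / (L*)^(p^k)` -/

section Modules

variable (p : ℕ) [Fact p.Prime] (L : Type*) [Field L] [NumberField L]

/-- `A`, the `p`-Sylow subgroup of the ideal class group of `L`, written additively. -/
def ClassP : Type _ := Additive (CommGroup.primaryComponent (ClassGroup (𝓞 L)) p)

instance : AddCommGroup (ClassP p L) :=
  inferInstanceAs (AddCommGroup (Additive (CommGroup.primaryComponent (ClassGroup (𝓞 L)) p)))

instance : Finite (ClassP p L) :=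
  inferInstanceAs (Finite (CommGroup.primaryComponent (ClassGroup (𝓞 L)) p))

variable {p L} in
/-- The inclusion of `A` in the ideal class group. -/
def ClassP.toClassGroup (x : ClassP p L) : ClassGroup (𝓞 L) :=
  (Additive.toMul x : CommGroup.primaryComponent (ClassGroup (𝓞 L)) p)

instance : DistribMulAction Gal(L/ℚ) (ClassP p L) where
  smul σ x := Additive.ofMul ⟨σ • x.toClassGroup, by
    obtain ⟨k, hk⟩ := (Additive.toMul x :
      CommGroup.primaryComponent (ClassGroup (𝓞 L)) p).2
    refine ⟨k, ?_⟩
    rw [← smul_pow']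
    exact (congrArg (σ • ·) hk).trans (smul_one σ)⟩
  one_smul x := Subtype.ext (one_smul Gal(L/ℚ) x.toClassGroup)
  mul_smul σ τ x := Subtype.ext (mul_smul σ τ x.toClassGroup)
  smul_zero σ := Subtype.ext (map_one (galClassHom σ))
  smul_add σ x y := Subtype.ext (smul_mul' σ x.toClassGroup y.toClassGroup)

theorem ClassP.toClassGroup_smul (σ : Gal(L/ℚ)) (x : ClassP p L) :
    (σ • x).toClassGroup = σ • x.toClassGroup := rfl

theorem ClassP.exists_pow_smul : ∃ N : ℕ, ∀ x : ClassP p L, p ^ N • x = 0 := by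
  refine ⟨Nat.card (ClassP p L), fun x => ?_⟩
  obtain ⟨k, hk⟩ := (Additive.toMul x : CommGroup.primaryComponent (ClassGroup (𝓞 L)) p).2
  have hx : p ^ k • x = 0 := Subtype.ext hk
  obtain ⟨j, -, hj⟩ := (Nat.dvd_prime_pow Fact.out).1 (addOrderOf_dvd_of_nsmul_eq_zero hx)
  apply addOrderOf_dvd_iff_nsmul_eq_zero.1
  rw [hj]
  apply pow_dvd_pow
  have h1 : addOrderOf x ≤ Nat.card (ClassP p L) := addOrderOf_le_card
  have h2 : j < p ^ j := Nat.lt_pow_self (Fact.out : p.Prime).one_lt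
  omega

instance : Module ℤ_[p] (ClassP p L) := padicModule p (ClassP.exists_pow_smul p L)

instance : SMulCommClass Gal(L/ℚ) ℤ_[p] (ClassP p L) :=
  padic_smulCommClass p (ClassP.exists_pow_smul p L)

/-- `L* / (L*)^(p^k)`, written additively. -/
def PowQuot (k : ℕ) : Type _ := Additive (Lˣ ⧸ (powMonoidHom (p ^ k) : Lˣ →* Lˣ).range)

variable {L} in
/-- The class of `α` in `L* / (L*)^(p^k)`. -/
def PowQuot.mk (k : ℕ) (α : Lˣ) : PowQuot p L k :=
  Additive.ofMul (QuotientGroup.mk α)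

variable (k : ℕ)

instance : AddCommGroup (PowQuot p L k) :=
  inferInstanceAs (AddCommGroup (Additive (Lˣ ⧸ (powMonoidHom (p ^ k) : Lˣ →* Lˣ).range)))

/-- The map induced by `σ` on `L* / (L*)^(p^k)`. -/
def PowQuot.galHom (σ : Gal(L/ℚ)) : PowQuot p L k →+ PowQuot p L k :=
  MonoidHom.toAdditive (QuotientGroup.map (powMonoidHom (p ^ k) : Lˣ →* Lˣ).range
    (powMonoidHom (p ^ k) : Lˣ →* Lˣ).range (MulDistribMulAction.toMonoidHom Lˣ σ) (by
      rintro _ ⟨α, rfl⟩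
      exact ⟨σ • α, (smul_pow' σ α (p ^ k)).symm⟩))

theorem PowQuot.galHom_mk (σ : Gal(L/ℚ)) (α : Lˣ) :
    PowQuot.galHom p L k σ (PowQuot.mk p k α) = PowQuot.mk p k (σ • α) := rfl

theorem PowQuot.mk_surjective (x : PowQuot p L k) : ∃ α : Lˣ, PowQuot.mk p k α = x :=
  QuotientGroup.mk_surjective (Additive.toMul x : Lˣ ⧸ (powMonoidHom (p ^ k) : Lˣ →* Lˣ).range)

instance : DistribMulAction Gal(L/ℚ) (PowQuot p L k) where
  smul σ x := PowQuot.galHom p L k σ x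
  one_smul x := by
    obtain ⟨α, rfl⟩ := PowQuot.mk_surjective p L k x
    exact (PowQuot.galHom_mk p L k 1 α).trans (by rw [one_smul])
  mul_smul σ τ x := by
    obtain ⟨α, rfl⟩ := PowQuot.mk_surjective p L k x
    exact (PowQuot.galHom_mk p L k (σ * τ) α).trans (by rw [mul_smul]; rfl)
  smul_zero σ := map_zero (PowQuot.galHom p L k σ)
  smul_add σ := map_add (PowQuot.galHom p L k σ)

theorem PowQuot.smul_mk (σ : Gal(L/ℚ)) (α : Lˣ) :
    σ • PowQuot.mk p k α = PowQuot.mk p k (σ • α) := rfl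

theorem PowQuot.exists_pow_smul : ∃ N : ℕ, ∀ x : PowQuot p L k, p ^ N • x = 0 := by
  refine ⟨k, fun x => ?_⟩
  obtain ⟨α, rfl⟩ := PowQuot.mk_surjective p L k x
  exact (QuotientGroup.eq_one_iff (α ^ p ^ k)).2 ⟨α, rfl⟩

instance : Module ℤ_[p] (PowQuot p L k) := padicModule p (PowQuot.exists_pow_smul p L k)

instance : SMulCommClass Gal(L/ℚ) ℤ_[p] (PowQuot p L k) :=
  padic_smulCommClass p (PowQuot.exists_pow_smul p L k)

end Modules

/-! ### The objects attached to `L = ℚ(ζ_p)` -/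

section Cyclotomic

variable (p : ℕ) [Fact p.Prime] (L : Type*) [Field L] [NumberField L]
  [IsCyclotomicExtension {p} ℚ L]

/-- `σ_{-1}`, the automorphism with `ζ ↦ ζ⁻¹` for every `p`-th root of unity `ζ`. -/
def sigmaNegOne : Gal(L/ℚ) := (IsCyclotomicExtension.Rat.galEquivZMod p L).symm (-1)

/-- `ω` is the Teichmüller character: `σ(ζ) = ζ ^ ω(σ)` for `σ ∈ Gal(L/ℚ)`, `ζ ∈ μ_p`. The power
`ζ ^ x` with `x ∈ ℤ_p` is `ζ ^ a` for any integer `a ≡ x` modulo `p`. -/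
def IsTeichmuller (ω : Gal(L/ℚ) →* ℤ_[p]ˣ) : Prop :=
  ∀ (σ : Gal(L/ℚ)) (ζ : L), ζ ^ p = 1 →
    σ ζ = ζ ^ (PadicInt.toZMod ((ω σ : ℤ_[p]ˣ) : ℤ_[p])).val

/-- `π = ζ_p - 1` in the ring of integers of `L`. -/
def piElt : 𝓞 L := (IsCyclotomicExtension.zeta_spec p ℚ L).toInteger - 1

/-- `L* ∩ U` with `U = 1 + π² ℤ_p[ζ_p]`: the `α = a / b` with `a, b` algebraic integers of `L`,
`b` prime to `p` and `a ≡ b` modulo `π²`. (The elements of `L` that lie in `ℤ_p[ζ_p]` are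
those of the localization of `𝓞 L` at `π`, that is the `a / b` with `b` prime to `p`.) -/
def unitsU : Set Lˣ :=
  {α | ∃ a b : 𝓞 L, IsCoprime b (p : 𝓞 L) ∧ piElt p L ^ 2 ∣ a - b ∧
    (α : L) * algebraMap (𝓞 L) L b = algebraMap (𝓞 L) L a}

/-- `ℐ`, the group of fractional ideals of `L` prime to `p`: the quotients of two integral ideals
prime to `p`. -/
def idealsPrimeTo : Subgroup (FractionalIdeal (𝓞 L)⁰ L)ˣ where
  carrier := {I | ∃ A B : Ideal (𝓞 L), IsCoprime A (Ideal.span {(p : 𝓞 L)}) ∧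
    IsCoprime B (Ideal.span {(p : 𝓞 L)}) ∧
    (I : FractionalIdeal (𝓞 L)⁰ L) * (B : FractionalIdeal (𝓞 L)⁰ L) = A}
  mul_mem' := by
    rintro I J ⟨A, B, hA, hB, h⟩ ⟨A', B', hA', hB', h'⟩
    refine ⟨A * A', B * B', hA.mul_left hA', hB.mul_left hB', ?_⟩
    rw [FractionalIdeal.coeIdeal_mul, FractionalIdeal.coeIdeal_mul, ← h, ← h', Units.val_mul]
    ring
  one_mem' := ⟨1, 1, isCoprime_one_left, isCoprime_one_left, by simp⟩
  inv_mem' := by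
    rintro I ⟨A, B, hA, hB, h⟩
    exact ⟨B, A, hB, hA, by rw [← h, ← mul_assoc, Units.inv_mul, one_mul]⟩

theorem galois_smul_coeIdeal (σ : Gal(L/ℚ)) (A : Ideal (𝓞 L)) :
    FractionalIdeal.ringEquivOfRingEquiv L L (galInt σ) (A : FractionalIdeal (𝓞 L)⁰ L) =
      ((A.map (galInt σ : 𝓞 L →+* 𝓞 L) : Ideal (𝓞 L)) : FractionalIdeal (𝓞 L)⁰ L) := by
  ext x
  rw [mem_galFrac]
  simp only [FractionalIdeal.mem_coeIdeal]
  constructor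
  · rintro ⟨_, ⟨a, ha, rfl⟩, rfl⟩
    exact ⟨galInt σ a, Ideal.mem_map_of_mem _ ha, rfl⟩
  · rintro ⟨b, hb, rfl⟩
    obtain ⟨a, ha, rfl⟩ := (Ideal.mem_map_of_equiv (galInt σ) b).1 hb
    exact ⟨a, ⟨a, ha, rfl⟩, rfl⟩

theorem isCoprime_map_span (σ : Gal(L/ℚ)) {A : Ideal (𝓞 L)}
    (hA : IsCoprime A (Ideal.span {(p : 𝓞 L)})) :
    IsCoprime (A.map (galInt σ : 𝓞 L →+* 𝓞 L)) (Ideal.span {(p : 𝓞 L)}) := by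
  rw [Ideal.isCoprime_iff_sup_eq] at hA ⊢
  have h := congrArg (Ideal.map (galInt σ : 𝓞 L →+* 𝓞 L)) hA
  rw [Ideal.map_sup, Ideal.map_span, Ideal.map_top] at h
  simpa using h

theorem galois_smul_mem_idealsPrimeTo (σ : Gal(L/ℚ)) {I : (FractionalIdeal (𝓞 L)⁰ L)ˣ}
    (hI : I ∈ idealsPrimeTo p L) : σ • I ∈ idealsPrimeTo p L := by
  obtain ⟨A, B, hA, hB, h⟩ := hI
  refine ⟨_, _, isCoprime_map_span p L σ hA, isCoprime_map_span p L σ hB, ?_⟩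
  rw [← galois_smul_coeIdeal, ← galois_smul_coeIdeal, ← h, map_mul]
  rfl

instance : MulDistribMulAction Gal(L/ℚ) (idealsPrimeTo p L) where
  smul σ I := ⟨σ • (I : (FractionalIdeal (𝓞 L)⁰ L)ˣ), galois_smul_mem_idealsPrimeTo p L σ I.2⟩
  one_smul _ := Subtype.ext (one_smul _ _)
  mul_smul _ _ _ := Subtype.ext (mul_smul _ _ _)
  smul_one _ := Subtype.ext (smul_one _)
  smul_mul _ _ _ := Subtype.ext (smul_mul' _ _ _)

theorem principal_mem_idealsPrimeTo {α : Lˣ} (hα : α ∈ unitsU p L) :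
    toPrincipalIdeal (𝓞 L) L α ∈ idealsPrimeTo p L := by
  obtain ⟨a, b, hb, hab, h⟩ := hα
  have hζ := IsCyclotomicExtension.zeta_spec p ℚ L
  have hbπ : IsCoprime b (piElt p L) :=
    hb.of_isCoprime_of_dvd_right hζ.toInteger_sub_one_dvd_prime'
  have haπ : IsCoprime a (piElt p L) := by
    obtain ⟨c, hc⟩ := hab
    have ha : a = b + piElt p L * (piElt p L * c) := by linear_combination hc
    rw [ha]
    exact hbπ.add_mul_left_left _
  have ha : IsCoprime a (p : 𝓞 L) := by
    have h1 : IsCoprime a (piElt p L ^ (p - 1)) := haπ.pow_right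
    exact h1.of_isCoprime_of_dvd_right
      (IsCyclotomicExtension.Rat.associated_zeta_sub_one_pow_prime p hζ).symm.dvd
  refine ⟨Ideal.span {a}, Ideal.span {b}, (Ideal.isCoprime_span_singleton_iff _ _).2 ha,
    (Ideal.isCoprime_span_singleton_iff _ _).2 hb, ?_⟩
  rw [coe_toPrincipalIdeal, FractionalIdeal.coeIdeal_span_singleton,
    FractionalIdeal.coeIdeal_span_singleton, FractionalIdeal.spanSingleton_mul_spanSingleton, h]

variable {p L}

/-- `α ^ β` for `α ∈ L*` and `β ∈ ℤ[Gal(L/ℚ)]`. -/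
def galPow (α : Lˣ) (β : MonoidAlgebra ℤ Gal(L/ℚ)) : Lˣ :=
  Additive.toMul ((Representation.ofMulDistribMulAction Gal(L/ℚ) Lˣ).asAlgebraHom β
    (Additive.ofMul α))

/-- `β` is the element `β(f)`: `f(α𝓞) = α ^ β` for all `α ∈ L* ∩ U`. -/
def HasBeta (f : idealsPrimeTo p L →* Lˣ) (β : MonoidAlgebra ℤ Gal(L/ℚ)) : Prop :=
  ∀ (α : Lˣ) (hα : α ∈ unitsU p L),
    f ⟨toPrincipalIdeal (𝓞 L) L α, principal_mem_idealsPrimeTo p L hα⟩ = galPow α β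

variable (p L)

/-- `𝒲`: the `ℤ[Gal(L/ℚ)]`-homomorphisms `f : ℐ → L*` with values in `U` for which some
`β(f) ∈ ℤ[Gal(L/ℚ)]` exists. -/
def calW : Set (idealsPrimeTo p L →* Lˣ) :=
  {f | (∀ (σ : Gal(L/ℚ)) (I : idealsPrimeTo p L), f (σ • I) = σ • f I) ∧
    (∀ I, f I ∈ unitsU p L) ∧ ∃ β, HasBeta f β}

/-- `𝒲⁻`: the `f ∈ 𝒲` with `σ_{-1} f = f⁻¹` (`-f` in additive notation). -/
def calWMinus : Set (idealsPrimeTo p L →* Lˣ) :=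
  {f | f ∈ calW p L ∧ ∀ I, sigmaNegOne p L • f I = (f I)⁻¹}

/-- `W`, the submodule of `L*` generated by all values `f(I)` with `f ∈ 𝒲` and `I ∈ ℐ`
(the subgroup that they generate is stable under `Gal(L/ℚ)`). -/
def groupW : Subgroup Lˣ :=
  Subgroup.closure {α | ∃ f ∈ calW p L, ∃ I, f I = α}

/-- `W (L*)^(p^k) / (L*)^(p^k)`, the image of `W` in `L* / (L*)^(p^k)`. -/
def groupWQuot (k : ℕ) : AddSubgroup (PowQuot p L k) :=
  (Subgroup.map (QuotientGroup.mk' (powMonoidHom (p ^ k) : Lˣ →* Lˣ).range)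
    (groupW p L)).toAddSubgroup

variable {p L} (ψ : Gal(L/ℚ) →* ℤ_[p]ˣ)

/-- `A(ψ) = e_ψ A`. -/
def classPsi : AddSubgroup (ClassP p L) := psiPart ψ ⊤

/-- `k(ψ)`, where `p ^ k(ψ)` is the exponent of `A(ψ)`. -/
def kPsi : ℕ := padicValNat p (AddMonoid.exponent (classPsi ψ))

/-- `e ∈ ℤ[Gal(L/ℚ)]⁻` with `e ≡ e_ψ` modulo `p ^ m`, a possible choice of `e_m(ψ)`. -/
def IsLiftEIdem (m : ℕ) (e : MonoidAlgebra ℤ Gal(L/ℚ)) : Prop :=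
  MonoidAlgebra.single (sigmaNegOne p L) 1 * e = -e ∧
    ∀ σ, (p : ℤ_[p]) ^ m ∣ ((e.coeff σ : ℤ) : ℤ_[p]) - (eIdem ψ).coeff σ

/-- `β_ψ = 2 n p^k(ψ) e_m(ψ)` with `n = |Cl(L)| / |A|`, where `e` is the chosen `e_m(ψ)`. -/
def betaPsi (e : MonoidAlgebra ℤ Gal(L/ℚ)) : MonoidAlgebra ℤ Gal(L/ℚ) :=
  (2 * (Nat.card (ClassGroup (𝓞 L)) / Nat.card (ClassP p L)) * p ^ kPsi ψ) • e

/-- `f` is an element `f_ψ`: it lies in `𝒲⁻` and `β(f) = β_ψ`. -/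
def IsFPsi (e : MonoidAlgebra ℤ Gal(L/ℚ)) (f : idealsPrimeTo p L →* Lˣ) : Prop :=
  f ∈ calWMinus p L ∧ HasBeta f (betaPsi ψ e)

end Cyclotomic

end JacobiSums

end

/-!
The proof is elementary: neither Stickelberger's theorem nor the unit theorem is needed.

*Construction of `f_ψ`.* An element `y ∈ L* ∩ U` with `σ_{-1} y = y⁻¹` is determined by the ideal
`(y)`: the quotient of two such elements is a unit of absolute value `1` at every embedding, hence a
root of unity by Kronecker's theorem, and `U` has no torsion (`eq_of_toPrincipalIdeal_eq`). So to
give an element of `𝒲⁻` with a prescribed odd `β` it suffices to find, for each `I` prime to `p`,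
such a generator of `I ^ β`; multiplicativity, equivariance and the values on principal ideals follow
from uniqueness (`exists_calWMinus_hasBeta`). For `β = 2 n p ^ k(ψ) e_m(ψ)` the ideal
`J = I ^ (n p ^ k(ψ) e_m(ψ))` is principal, as its class is the `p ^ k(ψ)`-th power of an element of
`A(ψ)`; if `J = (γ)`, then `γ / σ_{-1} γ` generates `J ^ 2 = I ^ β` and becomes an element of `U`
after multiplication by a `p`-th root of unity, because `ζ ≡ 1 + π` (`exists_anti_generator`).

*The induced map.* Every `g ∈ 𝒲` satisfies `(g(I)) = I ^ β(g)`, since the group of ideals is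
torsion-free (`toPrincipalIdeal_of_hasBeta`). Each `f_ψ((α))` with `α` prime to `p` is a
`p ^ k(ψ)`-th power (`powQuot_mk_isFPsi_principal`), so that `f_ψ` induces a homomorphism on `A`. If
`[I] ∈ A(ψ)` and `f_ψ(I) = γ ^ (p ^ k(ψ))`, then `I ^ (2 n e_m(ψ)) = (γ)`; as `e_m(ψ)` fixes `[I]`
and `2 n` is prime to `p`, the class of `I` is trivial (`isFPsi_injective`).

*Surjectivity.* For `g ∈ 𝒲`, `β(g)` kills the class group, whence `p ^ k(ψ) ∣ ψ(β(g))`. As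
`β(g) e_m(ψ) ≡ ψ(β(g)) e_ψ` modulo `p ^ m`, the divisor of `x ^ e_m(ψ)` is a `p ^ k(ψ)`-th power
`J ^ (p ^ k(ψ))` for all `x ∈ W` (`exists_ideal_pow_eq`). Then `f_ψ(J)` and `x ^ (2 n e_m(ψ) ^ 2)`
generate the same ideal, so they differ by a unit. Units have trivial `ψ`-component, because
`u / σ_{-1} u` is a root of unity and `ψ ≠ ω` (`psiProj_unit_eq_zero`). Hence `e_ψ x` is, up to a
factor prime to `p`, in the image of `A(ψ)` (`exists_preimage`).
-/

namespace JacobiSums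

/-! ### Exponents in the integral group ring -/

section GroupRingPow

variable {G M N : Type*} [Group G] [CommGroup M] [MulDistribMulAction G M]
  [CommGroup N] [MulDistribMulAction G N]

/-- `x ^ β` for `x` in a commutative group with an action of `G`, written multiplicatively, and
`β ∈ ℤ[G]`. For `M = L*` this is `galPow`, by definition. -/
noncomputable def groupRingPow (x : M) (β : MonoidAlgebra ℤ G) : M :=
  Additive.toMul ((Representation.ofMulDistribMulAction G M).asAlgebraHom β (Additive.ofMul x))

theorem groupRingPow_single (x : M) (σ : G) (c : ℤ) :
    groupRingPow x (MonoidAlgebra.single σ c) = (σ • x) ^ c := by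
  simp [groupRingPow, Representation.asAlgebraHom_single]

theorem groupRingPow_zero (x : M) : groupRingPow x (0 : MonoidAlgebra ℤ G) = 1 := by
  simp [groupRingPow]

theorem groupRingPow_add (x : M) (β γ : MonoidAlgebra ℤ G) :
    groupRingPow x (β + γ) = groupRingPow x β * groupRingPow x γ := by
  simp [groupRingPow]

theorem groupRingPow_neg (x : M) (β : MonoidAlgebra ℤ G) :
    groupRingPow x (-β) = (groupRingPow x β)⁻¹ := by
  simp [groupRingPow]

theorem groupRingPow_nsmul (x : M) (n : ℕ) (β : MonoidAlgebra ℤ G) :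
    groupRingPow x (n • β) = groupRingPow x β ^ n := by
  simp [groupRingPow]

theorem groupRingPow_exponent_mul (x : M) (β γ : MonoidAlgebra ℤ G) :
    groupRingPow x (β * γ) = groupRingPow (groupRingPow x γ) β := by
  simp [groupRingPow]

theorem groupRingPow_single_one_mul (x : M) (σ : G) (β : MonoidAlgebra ℤ G) :
    groupRingPow x (MonoidAlgebra.single σ 1 * β) = σ • groupRingPow x β := by
  rw [groupRingPow_exponent_mul, groupRingPow_single, zpow_one]

theorem groupRingPow_mul (x y : M) (β : MonoidAlgebra ℤ G) :
    groupRingPow (x * y) β = groupRingPow x β * groupRingPow y β := by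
  simp [groupRingPow]

theorem groupRingPow_pow (x : M) (n : ℕ) (β : MonoidAlgebra ℤ G) :
    groupRingPow (x ^ n) β = groupRingPow x β ^ n := by
  simp [groupRingPow]

theorem groupRingPow_eq_prod [Fintype G] (x : M) (β : MonoidAlgebra ℤ G) :
    groupRingPow x β = ∏ σ : G, (σ • x) ^ β.coeff σ := by
  induction β using MonoidAlgebra.induction_linear with
  | zero => simp [groupRingPow_zero]
  | add β γ hβ hγ =>
    rw [groupRingPow_add, hβ, hγ, ← Finset.prod_mul_distrib]
    exact Finset.prod_congr rfl fun σ _ => (zpow_add _ _ _).symm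
  | single τ c =>
    classical
    rw [groupRingPow_single, Finset.prod_eq_single τ]
    · simp
    · intro σ _ hσ
      simp [Finsupp.single_eq_of_ne hσ]
    · simp

theorem map_groupRingPow (f : M →* N) (hf : ∀ (σ : G) (x : M), f (σ • x) = σ • f x)
    (x : M) (β : MonoidAlgebra ℤ G) : f (groupRingPow x β) = groupRingPow (f x) β := by
  induction β using MonoidAlgebra.induction_linear with
  | zero => simp [groupRingPow_zero]
  | add β γ hβ hγ => rw [groupRingPow_add, groupRingPow_add, map_mul, hβ, hγ]
  | single τ c => rw [groupRingPow_single, groupRingPow_single, map_zpow, hf]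

theorem smul_groupRingPow (hG : ∀ σ τ : G, σ * τ = τ * σ) (σ : G) (x : M)
    (β : MonoidAlgebra ℤ G) : σ • groupRingPow x β = groupRingPow (σ • x) β :=
  map_groupRingPow (MulDistribMulAction.toMonoidHom M σ)
    (fun τ x => by
      simp only [MulDistribMulAction.toMonoidHom_apply]
      rw [← mul_smul, hG, mul_smul]) x β

theorem groupRingPow_mem {S : Subgroup M} (hS : ∀ (σ : G), ∀ x ∈ S, σ • x ∈ S) {x : M}
    (hx : x ∈ S) (β : MonoidAlgebra ℤ G) : groupRingPow x β ∈ S := by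
  induction β using MonoidAlgebra.induction_linear with
  | zero => simp [groupRingPow_zero, S.one_mem]
  | add β γ hβ hγ => rw [groupRingPow_add]; exact S.mul_mem hβ hγ
  | single τ c => rw [groupRingPow_single]; exact S.zpow_mem (hS τ x hx) c

end GroupRingPow

/-! ### The projection onto the `ψ`-component -/

section Projection

variable {p : ℕ} [Fact p.Prime]

/-- An integer congruent to `c ∈ ℤ_p` modulo `p ^ m` acts as `c` does on `p ^ m`-torsion. -/
theorem padic_smul_eq_zsmul {M : Type*} [AddCommGroup M] [Module ℤ_[p] M] {m : ℕ} {x : M}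
    (hx : p ^ m • x = 0) {z : ℤ} {c : ℤ_[p]} (h : (p : ℤ_[p]) ^ m ∣ (z : ℤ_[p]) - c) :
    c • x = z • x := by
  obtain ⟨d, hd⟩ := h
  have hz : (z : ℤ_[p]) = c + d * ((p ^ m : ℕ) : ℤ_[p]) := by
    push_cast
    linear_combination hd
  rw [← Int.cast_smul_eq_zsmul ℤ_[p] z x, hz, add_smul, mul_smul, Nat.cast_smul_eq_nsmul, hx,
    smul_zero, add_zero]

/-- Multiplication by an integer prime to `p` is injective on `p`-power torsion. -/
theorem eq_zero_of_nsmul_eq_zero {M : Type*} [AddCommGroup M] {m n : ℕ} {x : M}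
    (hx : p ^ m • x = 0) (hn : ¬ p ∣ n) (h : n • x = 0) : x = 0 := by
  have hc : Nat.Coprime (p ^ m) n :=
    Nat.Coprime.pow_left m ((Nat.Prime.coprime_iff_not_dvd Fact.out).2 hn)
  have h1 := Nat.dvd_gcd (addOrderOf_dvd_of_nsmul_eq_zero hx) (addOrderOf_dvd_of_nsmul_eq_zero h)
  rw [hc.gcd_eq_one, Nat.dvd_one, AddMonoid.addOrderOf_eq_one_iff] at h1
  exact h1

variable {G : Type*} [Group G] [Fintype G] (ψ : G →* ℤ_[p]ˣ)

theorem eIdem_coeff (σ : G) : (eIdem ψ).coeff σ =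
    Ring.inverse ((p : ℤ_[p]) - 1) * (((ψ σ)⁻¹ : ℤ_[p]ˣ) : ℤ_[p]) := by
  classical
  rw [eIdem, MonoidAlgebra.coeff_smul_apply, MonoidAlgebra.coeff_sum, Finsupp.finsetSum_apply,
    Finset.sum_eq_single σ]
  · simp
  · intro τ _ h
    simp [Finsupp.single_eq_of_ne h.symm]
  · simp

variable {M N : Type*} [AddCommGroup M] [Module ℤ_[p] M] [DistribMulAction G M]
  [SMulCommClass G ℤ_[p] M] [AddCommGroup N] [Module ℤ_[p] N] [DistribMulAction G N]
  [SMulCommClass G ℤ_[p] N]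

variable (M) in
/-- Multiplication by `e_ψ`, the projection of a `ℤ_p[G]`-module onto its `ψ`-component. -/
noncomputable def psiProj : M →ₗ[ℤ_[p]] M :=
  (Representation.ofDistribMulAction ℤ_[p] G M).asAlgebraHom (eIdem ψ)

theorem psiProj_apply (x : M) : psiProj ψ M x = Ring.inverse ((p : ℤ_[p]) - 1) •
    ∑ δ : G, (((ψ δ)⁻¹ : ℤ_[p]ˣ) : ℤ_[p]) • δ • x := by
  simp [psiProj, eIdem, Representation.asAlgebraHom_single]

theorem psiProj_eq_sum_coeff (x : M) :
    psiProj ψ M x = ∑ σ : G, (eIdem ψ).coeff σ • σ • x := by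
  simp only [psiProj_apply, eIdem_coeff, Finset.smul_sum, mul_smul]

theorem mem_psiPart {S : AddSubgroup M} {x : M} :
    x ∈ psiPart ψ S ↔ ∃ y ∈ S, psiProj ψ M y = x := Iff.rfl

theorem smul_psiProj (σ : G) (x : M) :
    σ • psiProj ψ M x = ((ψ σ : ℤ_[p]ˣ) : ℤ_[p]) • psiProj ψ M x := by
  rw [psiProj_apply, smul_comm, smul_comm _ (Ring.inverse _)]
  congr 1
  rw [Finset.smul_sum, Finset.smul_sum]
  refine Fintype.sum_equiv (Equiv.mulLeft σ) _ _ fun δ => ?_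
  rw [smul_comm σ, ← mul_smul σ, Equiv.coe_mulLeft, smul_smul]
  congr 1
  simp [mul_comm (((ψ δ)⁻¹ : ℤ_[p]ˣ) : ℤ_[p])]

theorem psiProj_smul (σ : G) (x : M) :
    psiProj ψ M (σ • x) = ((ψ σ : ℤ_[p]ˣ) : ℤ_[p]) • psiProj ψ M x := by
  rw [psiProj_apply, psiProj_apply, smul_comm _ (Ring.inverse _)]
  congr 1
  rw [Finset.smul_sum]
  refine Fintype.sum_equiv (Equiv.mulRight σ) _ _ fun δ => ?_
  rw [← mul_smul δ, Equiv.coe_mulRight, smul_smul]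
  congr 1
  simp [mul_comm]

theorem psiProj_eq_self (hG : Fintype.card G = p - 1) {x : M}
    (hx : ∀ σ : G, σ • x = ((ψ σ : ℤ_[p]ˣ) : ℤ_[p]) • x) : psiProj ψ M x = x := by
  have h1 : ∀ δ : G, (((ψ δ)⁻¹ : ℤ_[p]ˣ) : ℤ_[p]) • δ • x = x := fun δ => by
    rw [hx, smul_smul, Units.inv_mul, one_smul]
  have hp1 : 1 ≤ p := (Fact.out : p.Prime).one_le
  have hu : IsUnit ((p : ℤ_[p]) - 1) := by
    rw [← neg_sub, IsUnit.neg_iff]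
    exact IsLocalRing.isUnit_one_sub_self_of_mem_nonunits _ (PadicInt.p_nonunit)
  rw [psiProj_apply, Finset.sum_congr rfl fun δ _ => h1 δ, Finset.sum_const, Finset.card_univ, hG,
    ← Nat.cast_smul_eq_nsmul ℤ_[p], smul_smul, Nat.cast_sub hp1, Nat.cast_one,
    Ring.inverse_mul_cancel _ hu, one_smul]

theorem psiProj_psiProj (hG : Fintype.card G = p - 1) (x : M) :
    psiProj ψ M (psiProj ψ M x) = psiProj ψ M x :=
  psiProj_eq_self ψ hG fun σ => smul_psiProj ψ σ x

theorem psiProj_of_mem (hG : Fintype.card G = p - 1) {S : AddSubgroup M} {x : M}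
    (hx : x ∈ psiPart ψ S) : psiProj ψ M x = x := by
  obtain ⟨y, -, rfl⟩ := (mem_psiPart ψ).1 hx
  exact psiProj_psiProj ψ hG y

theorem smul_of_mem_psiPart {S : AddSubgroup M} {x : M}
    (hx : x ∈ psiPart ψ S) (σ : G) : σ • x = ((ψ σ : ℤ_[p]ˣ) : ℤ_[p]) • x := by
  obtain ⟨y, -, rfl⟩ := (mem_psiPart ψ).1 hx
  exact smul_psiProj ψ σ y

/-- On `p ^ m`-torsion `e_ψ` acts as any `e ∈ ℤ[G]` congruent to it modulo `p ^ m`. -/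
theorem psiProj_eq_sum_int {m : ℕ} {e : MonoidAlgebra ℤ G}
    (he : ∀ σ, (p : ℤ_[p]) ^ m ∣ ((e.coeff σ : ℤ) : ℤ_[p]) - (eIdem ψ).coeff σ) {x : M}
    (hx : p ^ m • x = 0) : psiProj ψ M x = ∑ σ : G, e.coeff σ • σ • x := by
  rw [psiProj_eq_sum_coeff]
  refine Finset.sum_congr rfl fun σ _ => padic_smul_eq_zsmul (m := m) ?_ (he σ)
  rw [smul_comm, hx, smul_zero]

/-- Homomorphisms of `ℤ[G]`-modules commute with `e_ψ` on `p ^ m`-torsion. -/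
theorem map_psiProj {m : ℕ} {e : MonoidAlgebra ℤ G}
    (he : ∀ σ, (p : ℤ_[p]) ^ m ∣ ((e.coeff σ : ℤ) : ℤ_[p]) - (eIdem ψ).coeff σ)
    (f : M →+ N) (hf : ∀ (σ : G) (x : M), f (σ • x) = σ • f x) {x : M}
    (hx : p ^ m • x = 0) : f (psiProj ψ M x) = psiProj ψ N (f x) := by
  rw [psiProj_eq_sum_int ψ he hx, psiProj_eq_sum_int ψ he (x := f x), map_sum]
  · simp only [map_zsmul, hf]
  · rw [← map_nsmul, hx, map_zero]

/-- The congruence `β e ≡ ψ(β) e_ψ` modulo `p ^ m`. -/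
theorem coeff_mul_lift_dvd {m : ℕ} {e : MonoidAlgebra ℤ G}
    (he : ∀ σ, (p : ℤ_[p]) ^ m ∣ ((e.coeff σ : ℤ) : ℤ_[p]) - (eIdem ψ).coeff σ)
    (β : MonoidAlgebra ℤ G) (τ : G) :
    (p : ℤ_[p]) ^ m ∣ (((β * e).coeff τ : ℤ) : ℤ_[p]) -
      (∑ σ : G, (β.coeff σ : ℤ_[p]) * ((ψ σ : ℤ_[p]ˣ) : ℤ_[p])) * (eIdem ψ).coeff τ := by
  induction β using MonoidAlgebra.induction_linear with
  | zero => simp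
  | add β γ hβ hγ =>
    convert dvd_add hβ hγ using 1
    simp only [add_mul, MonoidAlgebra.coeff_add, Finsupp.add_apply, Int.cast_add,
      Finset.sum_add_distrib]
    ring
  | single ρ c =>
    have h : ∑ σ : G, (((MonoidAlgebra.single ρ c).coeff σ : ℤ) : ℤ_[p]) *
        ((ψ σ : ℤ_[p]ˣ) : ℤ_[p]) = c * ((ψ ρ : ℤ_[p]ˣ) : ℤ_[p]) := by
      classical
      rw [Finset.sum_eq_single ρ]
      · simp
      · intro σ _ hσ
        simp [Finsupp.single_eq_of_ne hσ]
      · simp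
    rw [h, MonoidAlgebra.coeff_single_mul_apply]
    convert (he (ρ⁻¹ * τ)).mul_left (c : ℤ_[p]) using 1
    rw [eIdem_coeff, eIdem_coeff]
    push_cast
    simp only [map_mul, map_inv, mul_inv_rev, inv_inv, Units.val_mul]
    ring

end Projection

section Arithmetic

variable (p : ℕ) [Fact p.Prime] (L : Type*) [Field L] [NumberField L]
  [IsCyclotomicExtension {p} ℚ L]

/-! ### Congruences modulo `π` -/

theorem piElt_prime : Prime (piElt p L) :=
  (IsCyclotomicExtension.zeta_spec p ℚ L).zeta_sub_one_prime'

theorem piElt_dvd_natCast : piElt p L ∣ (p : 𝓞 L) :=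
  (IsCyclotomicExtension.zeta_spec p ℚ L).toInteger_sub_one_dvd_prime'

/-- The residue field of `π` is `𝔽_p`. -/
theorem exists_int_piElt_dvd_sub (b : 𝓞 L) : ∃ r : ℤ, piElt p L ∣ b - r := by
  have hζ := IsCyclotomicExtension.zeta_spec p ℚ L
  have hb : b ∈ Algebra.adjoin ℤ {hζ.toInteger} := by
    rw [IsCyclotomicExtension.Rat.adjoin_singleton_eq_top hζ]
    trivial
  induction hb using Algebra.adjoin_induction with
  | mem x hx => exact ⟨1, by rw [Set.mem_singleton_iff.1 hx]; simp [piElt]⟩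
  | algebraMap r => exact ⟨r, by simp⟩
  | add x y _ _ hx hy =>
    obtain ⟨r, hr⟩ := hx
    obtain ⟨s, hs⟩ := hy
    exact ⟨r + s, by convert dvd_add hr hs using 1; push_cast; ring⟩
  | mul x y _ _ hx hy =>
    obtain ⟨r, hr⟩ := hx
    obtain ⟨s, hs⟩ := hy
    refine ⟨r * s, ?_⟩
    convert dvd_add (hr.mul_right y) (hs.mul_left r) using 1
    push_cast
    ring

/-- `Gal(L/ℚ)` is the inertia group of `π`. -/
theorem piElt_dvd_galInt_sub (σ : Gal(L/ℚ)) (b : 𝓞 L) : piElt p L ∣ galInt σ b - b := by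
  have hζ := IsCyclotomicExtension.zeta_spec p ℚ L
  have hζ' : galInt σ hζ.toInteger =
      hζ.toInteger ^ (IsCyclotomicExtension.Rat.galEquivZMod p L σ).val.val := by
    apply RingOfIntegers.ext
    exact (IsCyclotomicExtension.Rat.galEquivZMod_apply_of_pow_eq p L σ hζ.pow_eq_one).trans
      (map_pow (algebraMap (𝓞 L) L) hζ.toInteger _).symm
  have hb : b ∈ Algebra.adjoin ℤ {hζ.toInteger} := by
    rw [IsCyclotomicExtension.Rat.adjoin_singleton_eq_top hζ]
    trivial
  induction hb using Algebra.adjoin_induction with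
  | mem x hx =>
    rw [Set.mem_singleton_iff.1 hx, hζ']
    rw [← sub_sub_sub_cancel_right _ _ 1]
    exact dvd_sub (sub_one_dvd_pow_sub_one _ _) dvd_rfl
  | algebraMap r => simp
  | add x y _ _ hx hy =>
    convert dvd_add hx hy using 1
    rw [map_add]
    ring
  | mul x y _ _ hx hy =>
    convert dvd_add (hx.mul_right (galInt σ y)) (hy.mul_left x) using 1
    rw [map_mul]
    ring

theorem piElt_pow_dvd_galInt (σ : Gal(L/ℚ)) {j : ℕ} {b : 𝓞 L} (h : piElt p L ^ j ∣ b) :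
    piElt p L ^ j ∣ galInt σ b := by
  have h1 : piElt p L ∣ galInt σ (piElt p L) :=
    (dvd_sub_left (dvd_refl _)).1 (piElt_dvd_galInt_sub p L σ _)
  have h2 := map_dvd (galInt σ) h
  rw [map_pow] at h2
  exact (pow_dvd_pow_of_dvd h1 j).trans h2

theorem isCoprime_natCast_iff {b : 𝓞 L} : IsCoprime b (p : 𝓞 L) ↔ ¬ piElt p L ∣ b := by
  constructor
  · intro h h1
    exact (piElt_prime p L).not_isUnit (h.isUnit_of_dvd' h1 (piElt_dvd_natCast p L))
  · intro h
    obtain ⟨r, c, hc⟩ := exists_int_piElt_dvd_sub p L b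
    have hr : ¬ (p : ℤ) ∣ r := by
      rintro ⟨s, rfl⟩
      refine h ?_
      have h1 : b = piElt p L * c + p * s := by
        push_cast at hc
        linear_combination hc
      rw [h1]
      exact dvd_add (dvd_mul_right _ _) ((piElt_dvd_natCast p L).mul_right _)
    have h1 : IsCoprime (r : 𝓞 L) (p : 𝓞 L) := by
      have := ((Nat.prime_iff_prime_int.1 (Fact.out : p.Prime)).coprime_iff_not_dvd.2 hr).symm
      simpa using this.map (Int.castRingHom (𝓞 L))
    have h2 : IsCoprime b (piElt p L) := by
      have h3 : b = r + piElt p L * c := by linear_combination hc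
      rw [h3]
      exact (h1.of_isCoprime_of_dvd_right (piElt_dvd_natCast p L)).add_mul_left_left _
    have h4 : IsCoprime b (piElt p L ^ (p - 1)) := h2.pow_right
    exact h4.of_isCoprime_of_dvd_right (IsCyclotomicExtension.Rat.associated_zeta_sub_one_pow_prime
      p (IsCyclotomicExtension.zeta_spec p ℚ L)).symm.dvd

theorem isCoprime_galInt (σ : Gal(L/ℚ)) {b : 𝓞 L} (h : IsCoprime b (p : 𝓞 L)) :
    IsCoprime (galInt σ b) (p : 𝓞 L) := by
  simpa using h.map (galInt σ : 𝓞 L →+* 𝓞 L)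

theorem piElt_sq_dvd_pow_sub_pow {a b : 𝓞 L} (h : piElt p L ∣ a - b) :
    piElt p L ^ 2 ∣ a ^ p - b ^ p := by
  obtain ⟨c, hc⟩ := h
  obtain ⟨d, hd⟩ := piElt_dvd_natCast p L
  obtain ⟨k, hk⟩ := Polynomial.powAddExpansion b (piElt p L * c) p
  rw [show a = b + piElt p L * c by linear_combination hc, hk]
  refine ⟨d * b ^ (p - 1) * c + k * c ^ 2, ?_⟩
  rw [hd]
  ring

theorem piElt_dvd_pow_sub_one {a : 𝓞 L} (ha : IsCoprime a (p : 𝓞 L)) :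
    piElt p L ∣ a ^ (p - 1) - 1 := by
  obtain ⟨r, hr⟩ := exists_int_piElt_dvd_sub p L a
  have h1 : ¬ (p : ℤ) ∣ r := by
    rintro ⟨s, rfl⟩
    refine (isCoprime_natCast_iff p L).1 ha ((dvd_sub_left ?_).1 hr)
    push_cast
    exact (piElt_dvd_natCast p L).mul_right _
  have h2 := Int.ModEq.pow_card_sub_one_eq_one (Fact.out : p.Prime) (n := r)
    ((Nat.prime_iff_prime_int.1 (Fact.out : p.Prime)).coprime_iff_not_dvd.2 h1).symm
  have h3 : piElt p L ∣ (r : 𝓞 L) ^ (p - 1) - 1 := by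
    refine (piElt_dvd_natCast p L).trans ?_
    have := map_dvd (Int.castRingHom (𝓞 L)) h2.symm.dvd
    simpa using this
  convert dvd_add (hr.trans (sub_dvd_pow_sub_pow a r (p - 1))) h3 using 1
  ring

/-! ### The groups `1 + π ^ (j + 1)` -/

/-- `L* ∩ (1 + π ^ (j + 1) ℤ_p[ζ_p])`, so that `j = 1` gives `L* ∩ U`. The exponent is `j + 1` and
not `j` so that the numerators of elements are prime to `p`, like the denominators. -/
def principalUnits (j : ℕ) : Subgroup Lˣ where
  carrier := {α | ∃ a b : 𝓞 L, IsCoprime b (p : 𝓞 L) ∧ piElt p L ^ (j + 1) ∣ a - b ∧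
    (α : L) * algebraMap (𝓞 L) L b = algebraMap (𝓞 L) L a}
  mul_mem' := by
    rintro α α' ⟨a, b, hb, h, e⟩ ⟨a', b', hb', h', e'⟩
    refine ⟨a * a', b * b', hb.mul_left hb', ?_, ?_⟩
    · convert dvd_add (h.mul_right a') (h'.mul_left b) using 1
      ring
    · rw [map_mul, map_mul, ← e, ← e', Units.val_mul]
      ring
  one_mem' := ⟨1, 1, isCoprime_one_left, by simp, by simp⟩
  inv_mem' := by
    rintro α ⟨a, b, hb, h, e⟩
    refine ⟨b, a, ?_, (dvd_sub_comm).1 h, ?_⟩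
    · rw [isCoprime_natCast_iff] at hb ⊢
      intro h1
      exact hb ((dvd_sub_right h1).1 ((dvd_pow_self _ j.succ_ne_zero).trans h))
    · rw [← e, Units.inv_mul_cancel_left]

variable {p L}

theorem mem_unitsU_iff {α : Lˣ} : α ∈ unitsU p L ↔ α ∈ principalUnits p L 1 := Iff.rfl

theorem smul_mem_principalUnits (j : ℕ) (σ : Gal(L/ℚ)) (α : Lˣ) (h : α ∈ principalUnits p L j) :
    σ • α ∈ principalUnits p L j := by
  obtain ⟨a, b, hb, h, e⟩ := h
  refine ⟨galInt σ a, galInt σ b, isCoprime_galInt p L σ hb, ?_, ?_⟩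
  · rw [← map_sub]
    exact piElt_pow_dvd_galInt p L σ h
  · exact (map_mul σ _ _).symm.trans (congrArg σ e)

theorem pow_mem_principalUnits_one {α : Lˣ} (h : α ∈ principalUnits p L 0) :
    α ^ p ∈ principalUnits p L 1 := by
  obtain ⟨a, b, hb, h, e⟩ := h
  rw [zero_add, pow_one] at h
  refine ⟨a ^ p, b ^ p, hb.pow_left, piElt_sq_dvd_pow_sub_pow p L h, ?_⟩
  rw [map_pow, map_pow, ← e, Units.val_pow_eq_pow_val, mul_pow]

/-- Some multiple of an element of `1 + π ℤ_p[ζ_p]` by a `p`-th root of unity lies in `U`, since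
`ζ ≡ 1 + π`. -/
theorem exists_root_mul_mem_principalUnits_one {α : Lˣ} (h : α ∈ principalUnits p L 0) :
    ∃ ξ : Lˣ, ξ ^ p = 1 ∧ ξ * α ∈ principalUnits p L 1 := by
  obtain ⟨a, b, hb, ⟨d, hd⟩, e⟩ := h
  have hζ := IsCyclotomicExtension.zeta_spec p ℚ L
  -- `j` solves `j b + d ≡ 0` modulo `π`, where `a = b + π d`
  obtain ⟨u, v, huv⟩ := hb
  obtain ⟨j, hj⟩ := exists_int_piElt_dvd_sub p L (-(u * d))
  obtain ⟨n, hn⟩ : ∃ n : ℕ, piElt p L ∣ -(u * d) - n := by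
    refine ⟨(j % p).toNat, ?_⟩
    have h1 : ((j % p).toNat : ℤ) = j % p :=
      Int.toNat_of_nonneg (Int.emod_nonneg _ (by exact_mod_cast (Fact.out : p.Prime).ne_zero))
    have h2 : (((j % p).toNat : ℕ) : 𝓞 L) = j - p * (j / p : ℤ) := by
      have := congrArg (Int.cast : ℤ → 𝓞 L) (h1.trans (Int.emod_def j p))
      push_cast at this ⊢
      exact this
    rw [h2]
    convert dvd_add hj ((piElt_dvd_natCast p L).mul_right ((j / p : ℤ) : 𝓞 L)) using 1
    ring
  obtain ⟨w, hw⟩ := hn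
  obtain ⟨q, hq⟩ := piElt_dvd_natCast p L
  obtain ⟨k, hk⟩ := Polynomial.powAddExpansion 1 (piElt p L) n
  have hz : hζ.toInteger = 1 + piElt p L := by simp [piElt]
  have hu : IsUnit (IsCyclotomicExtension.zeta p ℚ L) := hζ.isUnit (Fact.out : p.Prime).ne_zero
  refine ⟨hu.unit ^ n, ?_, hζ.toInteger ^ n * a, b, ⟨u, v, huv⟩, ?_, ?_⟩
  · rw [← pow_mul, mul_comm, pow_mul]
    have : hu.unit ^ p = 1 := Units.ext hζ.pow_eq_one
    rw [this, one_pow]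
  · rw [hz, hk]
    simp only [one_pow, mul_one]
    rw [zero_add, pow_one] at hd
    refine ⟨n * d + k * a + v * q * d - w * b, ?_⟩
    have ha : a = b + piElt p L * d := by linear_combination hd
    rw [ha]
    linear_combination (-piElt p L * d) * huv + piElt p L * v * d * hq - piElt p L * b * hw
  · rw [map_mul, map_pow, ← e, Units.val_mul, Units.val_pow_eq_pow_val]
    exact mul_assoc _ _ _

end Arithmetic

/-! ### Complex conjugation and roots of unity -/

section Conjugation

variable (p : ℕ) [Fact p.Prime] (L : Type*) [Field L] [NumberField L]
  [IsCyclotomicExtension {p} ℚ L]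

theorem galois_mul_comm (p : ℕ) [Fact p.Prime] {L : Type*} [Field L] [NumberField L]
    [IsCyclotomicExtension {p} ℚ L] (σ τ : Gal(L/ℚ)) : σ * τ = τ * σ := by
  apply (IsCyclotomicExtension.Rat.galEquivZMod p L).injective
  rw [map_mul, map_mul, mul_comm]

theorem card_galois : Fintype.card Gal(L/ℚ) = p - 1 := by
  rw [← Nat.card_eq_fintype_card,
    Nat.card_congr (IsCyclotomicExtension.Rat.galEquivZMod p L).toEquiv, Nat.card_eq_fintype_card,
    ZMod.card_units_eq_totient, Nat.totient_prime Fact.out]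

theorem sigmaNegOne_mul_self : sigmaNegOne p L * sigmaNegOne p L = 1 := by
  rw [sigmaNegOne, ← map_mul, neg_one_mul, neg_neg, map_one]

theorem sigmaNegOne_apply_root {ξ : L} (hξ : ξ ^ p = 1) : sigmaNegOne p L ξ = ξ⁻¹ := by
  have h0 : ξ ≠ 0 := by
    rintro rfl
    rw [zero_pow (Fact.out : p.Prime).ne_zero] at hξ
    exact zero_ne_one hξ
  have h2 : 1 ≤ p := (Fact.out : p.Prime).one_le
  have hv : ((-1 : (ZMod p)ˣ) : ZMod p).val = p - 1 := by
    obtain ⟨n, rfl⟩ : ∃ n, p = n + 1 := ⟨p - 1, by omega⟩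
    rw [Units.val_neg, Units.val_one, ZMod.val_neg_one, Nat.add_sub_cancel]
  rw [IsCyclotomicExtension.Rat.galEquivZMod_apply_of_pow_eq p L _ hξ, sigmaNegOne,
    MulEquiv.apply_symm_apply, hv]
  exact eq_inv_of_mul_eq_one_left (by rw [← pow_succ, Nat.sub_add_cancel h2, hξ])

/-- `σ_{-1}` is complex conjugation for every embedding `L → ℂ`. -/
theorem embedding_sigmaNegOne (φ : L →+* ℂ) (x : L) :
    φ (sigmaNegOne p L x) = (starRingEnd ℂ) (φ x) := by
  have hζ := IsCyclotomicExtension.zeta_spec p ℚ L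
  have h : (φ.comp (sigmaNegOne p L : L →+* L)).toRatAlgHom =
      ((starRingEnd ℂ).comp φ).toRatAlgHom := by
    apply (hζ.powerBasis ℚ).algHom_ext
    rw [IsPrimitiveRoot.powerBasis_gen]
    change φ (sigmaNegOne p L _) = (starRingEnd ℂ) (φ _)
    rw [sigmaNegOne_apply_root p L hζ.pow_eq_one, map_inv₀, Complex.inv_eq_conj]
    refine Complex.norm_eq_one_of_pow_eq_one (n := p) ?_ (Fact.out : p.Prime).ne_zero
    rw [← map_pow, hζ.pow_eq_one, map_one]
  exact congrArg (fun f => f x) h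

variable {p L}

/-- Kronecker's theorem, for algebraic integers `x` with `x * σ_{-1} x = 1`. -/
theorem exists_pow_eq_one_of_anti {x : Lˣ} (hi : IsIntegral ℤ (x : L))
    (hx : sigmaNegOne p L • x = x⁻¹) : ∃ n, 0 < n ∧ x ^ n = 1 := by
  obtain ⟨n, hn, h⟩ := NumberField.Embeddings.pow_eq_one_of_norm_eq_one L ℂ hi (fun φ => by
    have h1 : φ (sigmaNegOne p L x) = φ (x : L)⁻¹ := by
      rw [← Units.val_inv_eq_inv_val, ← hx]
      rfl
    have h2 : φ (x : L) ≠ 0 := (map_ne_zero φ).2 x.ne_zero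
    rw [embedding_sigmaNegOne, map_inv₀, ← mul_eq_one_iff_eq_inv₀ h2, mul_comm,
      Complex.mul_conj, Complex.normSq_eq_norm_sq] at h1
    have h3 : ‖φ (x : L)‖ ^ 2 = 1 := by exact_mod_cast h1
    exact (pow_eq_one_iff_of_nonneg (norm_nonneg _) two_ne_zero).1 h3)
  exact ⟨n, hn, Units.ext (by simpa using h)⟩

theorem exists_neg_zeta_pow (hp : 5 ≤ p) {x : Lˣ} {n : ℕ} (hn : 0 < n) (hx : x ^ n = 1) :
    ∃ r, (x : L) = (-IsCyclotomicExtension.zeta p ℚ L) ^ r := by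
  have hodd : Odd p := (Fact.out : p.Prime).odd_of_ne_two (by omega)
  refine (IsCyclotomicExtension.zeta_spec p ℚ L).exists_neg_pow_of_isOfFinOrder hodd ?_
  exact isOfFinOrder_iff_pow_eq_one.2 ⟨n, hn, by
    rw [← Units.val_pow_eq_pow_val, hx, Units.val_one]⟩

theorem root_of_unity_sq_pow (hp : 5 ≤ p) {x : Lˣ} {n : ℕ} (hn : 0 < n) (hx : x ^ n = 1) :
    (x ^ 2) ^ p = 1 := by
  obtain ⟨r, hr⟩ := exists_neg_zeta_pow hp hn hx
  apply Units.ext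
  rw [Units.val_pow_eq_pow_val, Units.val_pow_eq_pow_val, hr, ← pow_mul, ← pow_mul,
    show r * (2 * p) = 2 * (p * r) by ring, pow_mul, neg_sq, ← pow_mul, mul_left_comm, pow_mul,
    (IsCyclotomicExtension.zeta_spec p ℚ L).pow_eq_one]
  simp

theorem not_piElt_dvd_two (hp : 5 ≤ p) : ¬ piElt p L ∣ 2 := by
  rw [← isCoprime_natCast_iff]
  have h : IsCoprime (2 : ℤ) (p : ℤ) := by
    refine Nat.Coprime.isCoprime ((Nat.coprime_primes Nat.prime_two Fact.out).2 (by omega))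
  simpa using h.map (Int.castRingHom (𝓞 L))

/-- The group `U` has no torsion: `(-ζ) ^ r ∈ U` forces `r` even, modulo `π`, and then `p ∣ r`,
modulo `π ^ 2`. -/
theorem root_of_unity_eq_one (hp : 5 ≤ p) {x : Lˣ} {n : ℕ} (hn : 0 < n) (hx : x ^ n = 1)
    (hU : x ∈ principalUnits p L 1) : x = 1 := by
  have hζ := IsCyclotomicExtension.zeta_spec p ℚ L
  obtain ⟨r, hr⟩ := exists_neg_zeta_pow hp hn hx
  obtain ⟨a, b, hb, hab, e⟩ := hU
  have he : (-hζ.toInteger) ^ r * b = a := by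
    apply RingOfIntegers.ext
    refine Eq.trans ?_ e
    rw [hr]
    exact (map_mul _ _ _).trans (congrArg (· * _) (map_pow (algebraMap (𝓞 L) L) _ r))
  have hbπ : ¬ piElt p L ∣ b := (isCoprime_natCast_iff p L).1 hb
  have hdvd : piElt p L ^ 2 ∣ (-hζ.toInteger) ^ r - 1 := by
    rw [← he, show (-hζ.toInteger) ^ r * b - b = ((-hζ.toInteger) ^ r - 1) * b by ring] at hab
    exact (piElt_prime p L).pow_dvd_of_dvd_mul_right 2 hbπ hab
  have hz : hζ.toInteger = 1 + piElt p L := by simp [piElt]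
  have h1 : piElt p L ∣ hζ.toInteger ^ r - 1 := sub_one_dvd_pow_sub_one _ _
  rcases Nat.even_or_odd r with h2 | h2
  · rw [h2.neg_pow, hz] at hdvd
    obtain ⟨k, hk⟩ := Polynomial.powAddExpansion 1 (piElt p L) r
    rw [hk] at hdvd
    have h3 : piElt p L ∣ (r : 𝓞 L) := by
      have h4 : piElt p L ^ 2 ∣ piElt p L * r := by
        convert dvd_sub hdvd (dvd_mul_left (piElt p L ^ 2) k) using 1
        ring
      rw [sq] at h4
      exact (mul_dvd_mul_iff_left (piElt_prime p L).ne_zero).1 h4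
    have h5 : p ∣ r := by
      by_contra h
      have h6 := ((Nat.Prime.coprime_iff_not_dvd Fact.out).2 h).symm.isCoprime.map
        (Int.castRingHom (𝓞 L))
      refine (isCoprime_natCast_iff p L).1 ?_ h3
      simpa using h6
    obtain ⟨s, rfl⟩ := h5
    apply Units.ext
    rw [hr, h2.neg_pow, pow_mul, hζ.pow_eq_one, one_pow, Units.val_one]
  · exfalso
    rw [h2.neg_pow] at hdvd
    have h3 := dvd_add ((dvd_pow_self _ two_ne_zero).trans hdvd) h1
    refine not_piElt_dvd_two (p := p) (L := L) hp ?_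
    rw [← dvd_neg]
    convert h3 using 1
    ring

end Conjugation

/-! ### Ideals prime to `p` -/

section Ideals

theorem toPrincipalIdeal_eq_one_isIntegral {L : Type*} [Field L] [NumberField L] {x : Lˣ}
    (h : toPrincipalIdeal (𝓞 L) L x = 1) : IsIntegral ℤ (x : L) := by
  rw [toPrincipalIdeal_eq_iff, Units.val_one] at h
  have h1 : (x : L) ∈ (1 : FractionalIdeal (𝓞 L)⁰ L) := by
    rw [← h]
    exact FractionalIdeal.mem_spanSingleton_self _ _
  obtain ⟨y, hy⟩ := (FractionalIdeal.mem_one_iff _).1 h1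
  rw [← hy]
  exact RingOfIntegers.isIntegral_coe y

theorem mk_eq_one_iff_exists {L : Type*} [Field L] [NumberField L]
    {I : (FractionalIdeal (𝓞 L)⁰ L)ˣ} :
    ClassGroup.mk L I = 1 ↔ ∃ α, toPrincipalIdeal (𝓞 L) L α = I := by
  rw [← (ClassGroup.equiv L).map_eq_one_iff, classGroup_equiv_mk_self, QuotientGroup.eq_one_iff]
  rfl

/-- The group of fractional ideals of a number field is torsion-free. -/
theorem fractionalIdeal_pow_injective {L : Type*} [Field L] [NumberField L]
    {I J : (FractionalIdeal (𝓞 L)⁰ L)ˣ} {n : ℕ} (hn : n ≠ 0) (h : I ^ n = J ^ n) : I = J := by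
  have key : ∀ K : (FractionalIdeal (𝓞 L)⁰ L)ˣ, K ^ n = 1 → K = 1 := by
    intro K hK
    obtain ⟨a, A, ha, hA⟩ := FractionalIdeal.exists_eq_spanSingleton_mul (K : FractionalIdeal (𝓞 L)⁰ L)
    have ha' : algebraMap (𝓞 L) L a ≠ 0 := by simpa using ha
    -- `a K = A` with `A` integral, so `(a) ^ n = A ^ n`
    have h1 : ((Ideal.span {a} : Ideal (𝓞 L)) : FractionalIdeal (𝓞 L)⁰ L) * K = A := by
      rw [hA, FractionalIdeal.coeIdeal_span_singleton, ← mul_assoc,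
        FractionalIdeal.spanSingleton_mul_spanSingleton, mul_inv_cancel₀ ha',
        FractionalIdeal.spanSingleton_one, one_mul]
    have h2 : (Ideal.span {a} : Ideal (𝓞 L)) ^ n = A ^ n := by
      apply FractionalIdeal.coeIdeal_injective (K := L)
      simp only [FractionalIdeal.coeIdeal_pow]
      rw [← h1, mul_pow, ← Units.val_pow_eq_pow_val, hK, Units.val_one, mul_one]
    rw [pow_left_injective hn h2] at h1
    have hA0 : (A : FractionalIdeal (𝓞 L)⁰ L) ≠ 0 := by
      rw [← pow_left_injective hn h2, FractionalIdeal.coeIdeal_span_singleton]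
      exact FractionalIdeal.spanSingleton_ne_zero_iff.2 ha'
    exact Units.ext (mul_left_cancel₀ hA0 (h1.trans (mul_one _).symm))
  rw [← mul_inv_eq_one]
  apply key
  rw [mul_pow, inv_pow, h, mul_inv_cancel]

variable {p : ℕ} [Fact p.Prime] {L : Type*} [Field L] [NumberField L]
  [IsCyclotomicExtension {p} ℚ L]

theorem isCoprime_span_natCast_of_not_le {A : Ideal (𝓞 L)}
    (h : ¬ A ≤ Ideal.span {piElt p L}) : IsCoprime A (Ideal.span {(p : 𝓞 L)}) := by
  obtain ⟨b, hb, h1⟩ := SetLike.not_le_iff_exists.1 h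
  rw [Ideal.mem_span_singleton, ← isCoprime_natCast_iff] at h1
  have h2 := (Ideal.isCoprime_span_singleton_iff b (p : 𝓞 L)).2 h1
  rw [Ideal.isCoprime_iff_sup_eq] at h2 ⊢
  exact top_le_iff.1 (h2.ge.trans (sup_le_sup_right ((Ideal.span_singleton_le_iff_mem _).2 hb) _))

/-- The only prime above `p` is the principal ideal `(π)`, which can be removed from any ideal
without changing its class. -/
theorem exists_idealsPrimeTo_mk_eq (c : ClassGroup (𝓞 L)) :
    ∃ I : idealsPrimeTo p L, ClassGroup.mk L (I : (FractionalIdeal (𝓞 L)⁰ L)ˣ) = c := by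
  obtain ⟨⟨A, hA⟩, rfl⟩ := ClassGroup.mk0_surjective c
  have hπ : Prime (Ideal.span {piElt p L}) := by
    rw [Ideal.prime_iff_isPrime]
    · exact (Ideal.span_singleton_prime (piElt_prime p L).ne_zero).2 (piElt_prime p L)
    · simpa using (piElt_prime p L).ne_zero
  obtain ⟨B, hB, hnd⟩ := (FiniteMultiplicity.of_prime_left hπ
    (nonZeroDivisors.ne_zero hA)).exists_eq_pow_mul_and_not_dvd
  set k := multiplicity (Ideal.span {piElt p L}) A
  have hB0 : B ∈ (Ideal (𝓞 L))⁰ := by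
    refine mem_nonZeroDivisors_of_ne_zero ?_
    rintro rfl
    exact hnd (dvd_zero _)
  rw [Ideal.dvd_iff_le] at hnd
  refine ⟨⟨FractionalIdeal.mk0 L ⟨B, hB0⟩, B, 1, isCoprime_span_natCast_of_not_le hnd,
    isCoprime_one_left, by simp⟩, ?_⟩
  rw [ClassGroup.mk_mk0, ClassGroup.mk0_eq_mk0_iff]
  refine ⟨piElt p L ^ k, 1, pow_ne_zero _ (piElt_prime p L).ne_zero, one_ne_zero, ?_⟩
  rw [Ideal.span_singleton_one, ← Ideal.one_eq_top, one_mul, ← Ideal.span_singleton_pow]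
  exact hB.symm

/-- A generator of a principal ideal prime to `p` is a quotient of integers prime to `p`. -/
theorem exists_coprime_fraction {α : Lˣ}
    (h : toPrincipalIdeal (𝓞 L) L α ∈ idealsPrimeTo p L) :
    ∃ a b : 𝓞 L, IsCoprime a (p : 𝓞 L) ∧ IsCoprime b (p : 𝓞 L) ∧
      (α : L) * algebraMap (𝓞 L) L b = algebraMap (𝓞 L) L a := by
  obtain ⟨A, B, hA, hB, h⟩ := h
  rw [coe_toPrincipalIdeal] at h
  obtain ⟨b, hb, q, hq, hbq⟩ := Ideal.isCoprime_iff_exists.1 hB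
  have hbp : IsCoprime b (p : 𝓞 L) := by
    obtain ⟨s, rfl⟩ := Ideal.mem_span_singleton'.1 hq
    exact ⟨1, s, by rw [one_mul, hbq]⟩
  obtain ⟨a, ha, hab⟩ : ∃ a ∈ A, algebraMap (𝓞 L) L a = α * algebraMap (𝓞 L) L b := by
    have h1 : (α : L) * algebraMap (𝓞 L) L b ∈ (A : FractionalIdeal (𝓞 L)⁰ L) := by
      rw [← h]
      exact FractionalIdeal.mul_mem_mul (FractionalIdeal.mem_spanSingleton_self _ _)
        (FractionalIdeal.mem_coeIdeal_of_mem _ hb)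
    exact (FractionalIdeal.mem_coeIdeal _).1 h1
  refine ⟨a, b, ?_, hbp, hab.symm⟩
  -- `(a) B = A (b)` is a product of ideals prime to `p`
  have h2 : Ideal.span {a} * B = A * Ideal.span {b} := by
    apply FractionalIdeal.coeIdeal_injective (K := L)
    simp only [FractionalIdeal.coeIdeal_mul, FractionalIdeal.coeIdeal_span_singleton]
    rw [← h, hab, ← FractionalIdeal.spanSingleton_mul_spanSingleton]
    ring
  have h3 : IsCoprime (A * Ideal.span {b}) (Ideal.span {(p : 𝓞 L)}) :=
    hA.mul_left ((Ideal.isCoprime_span_singleton_iff _ _).2 hbp)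
  rw [← h2] at h3
  exact (Ideal.isCoprime_span_singleton_iff _ _).1 h3.of_mul_left_left

theorem div_smul_mem_principalUnits {α : Lˣ}
    (h : toPrincipalIdeal (𝓞 L) L α ∈ idealsPrimeTo p L) (σ : Gal(L/ℚ)) :
    α / σ • α ∈ principalUnits p L 0 := by
  obtain ⟨a, b, ha, hb, e⟩ := exists_coprime_fraction h
  refine ⟨a * galInt σ b, b * galInt σ a, hb.mul_left (isCoprime_galInt p L σ ha), ?_, ?_⟩
  · convert dvd_sub ((piElt_dvd_galInt_sub p L σ b).mul_left a)
      ((piElt_dvd_galInt_sub p L σ a).mul_left b) using 1 <;> ring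
  · have h1 : σ (α : L) * algebraMap (𝓞 L) L (galInt σ b) = algebraMap (𝓞 L) L (galInt σ a) :=
      (map_mul σ _ _).symm.trans (congrArg σ e)
    have h2 : σ (α : L) ≠ 0 := (map_ne_zero σ).2 α.ne_zero
    have h3 : ((σ • α : Lˣ) : L) = σ α := rfl
    rw [map_mul, map_mul, ← e, ← h1, Units.val_div_eq_div_val, h3]
    field_simp

theorem pow_mem_principalUnits {α : Lˣ}
    (h : toPrincipalIdeal (𝓞 L) L α ∈ idealsPrimeTo p L) :
    α ^ ((p - 1) * p) ∈ principalUnits p L 1 := by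
  obtain ⟨a, b, ha, hb, e⟩ := exists_coprime_fraction h
  rw [pow_mul]
  refine pow_mem_principalUnits_one ⟨a ^ (p - 1), b ^ (p - 1), hb.pow_left, ?_, ?_⟩
  · convert dvd_sub (piElt_dvd_pow_sub_one p L ha) (piElt_dvd_pow_sub_one p L hb) using 1 <;> ring
  · rw [map_pow, map_pow, ← e, Units.val_pow_eq_pow_val, mul_pow]

/-- Some power of every ideal prime to `p` is generated by an element of `U`. -/
theorem exists_pow_eq_principal (I : idealsPrimeTo p L) :
    ∃ h : ℕ, h ≠ 0 ∧ ∃ α ∈ unitsU p L,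
      toPrincipalIdeal (𝓞 L) L α = (I : (FractionalIdeal (𝓞 L)⁰ L)ˣ) ^ h := by
  have h1 : ClassGroup.mk L ((I : (FractionalIdeal (𝓞 L)⁰ L)ˣ) ^ Nat.card (ClassGroup (𝓞 L))) =
      1 := by
    rw [map_pow, pow_card_eq_one']
  obtain ⟨α, hα⟩ := mk_eq_one_iff_exists.1 h1
  have hp := (Fact.out : p.Prime).two_le
  refine ⟨Nat.card (ClassGroup (𝓞 L)) * ((p - 1) * p), mul_ne_zero Nat.card_pos.ne'
    (mul_ne_zero (by omega) (by omega)), α ^ ((p - 1) * p), pow_mem_principalUnits ?_, ?_⟩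
  · rw [hα]
    exact pow_mem I.2 _
  · rw [map_pow, hα, ← pow_mul]

/-- An element of `U` with `σ_{-1} x = x⁻¹` is determined by the ideal it generates. -/
theorem eq_of_toPrincipalIdeal_eq (hp : 5 ≤ p) {x y : Lˣ} (hx : x ∈ unitsU p L)
    (hy : y ∈ unitsU p L) (hx' : sigmaNegOne p L • x = x⁻¹) (hy' : sigmaNegOne p L • y = y⁻¹)
    (h : toPrincipalIdeal (𝓞 L) L x = toPrincipalIdeal (𝓞 L) L y) : x = y := by
  rw [← div_eq_one]
  obtain ⟨n, hn, h1⟩ := exists_pow_eq_one_of_anti (p := p) (x := x / y)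
    (toPrincipalIdeal_eq_one_isIntegral (by rw [map_div, h, div_self']))
    (by rw [smul_div', hx', hy', inv_div_inv, inv_div])
  exact root_of_unity_eq_one hp hn h1 (div_mem (mem_unitsU_iff.1 hx) (mem_unitsU_iff.1 hy))

/-- If `u` is a unit, `u / σ_{-1} u` is a root of unity. -/
theorem unit_div_conj_sq_pow (hp : 5 ≤ p) {u : Lˣ} (hu : toPrincipalIdeal (𝓞 L) L u = 1) :
    ((u / sigmaNegOne p L • u) ^ 2) ^ p = 1 := by
  obtain ⟨n, hn, h1⟩ := exists_pow_eq_one_of_anti (p := p) (x := u / sigmaNegOne p L • u)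
    (toPrincipalIdeal_eq_one_isIntegral (by
      rw [map_div, ← galois_smul_principal, hu, smul_one, div_one]))
    (by rw [smul_div', ← mul_smul, sigmaNegOne_mul_self, one_smul, inv_div])
  exact root_of_unity_sq_pow hp hn h1

end Ideals

/-! ### The `p`-part of the class group -/

section ClassGroupPart

variable (p : ℕ) [Fact p.Prime] {L : Type*} [Field L] [NumberField L]

theorem ClassP.toClassGroup_injective :
    Function.Injective (ClassP.toClassGroup : ClassP p L → ClassGroup (𝓞 L)) :=
  fun _ _ h => Subtype.ext h

variable {p}

theorem ClassP.toClassGroup_add (x y : ClassP p L) :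
    (x + y).toClassGroup = x.toClassGroup * y.toClassGroup := rfl

theorem ClassP.toClassGroup_zero : (0 : ClassP p L).toClassGroup = 1 := rfl

theorem ClassP.toClassGroup_nsmul (n : ℕ) (x : ClassP p L) :
    (n • x).toClassGroup = x.toClassGroup ^ n := rfl

theorem ClassP.toClassGroup_sum {ι : Type*} (s : Finset ι) (x : ι → ClassP p L) :
    (∑ i ∈ s, x i).toClassGroup = ∏ i ∈ s, (x i).toClassGroup := by
  classical
  induction s using Finset.induction_on with
  | empty => rfl
  | insert i s hi h => rw [Finset.sum_insert hi, Finset.prod_insert hi, toClassGroup_add, h]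

theorem ClassP.toClassGroup_sum_zsmul (β : MonoidAlgebra ℤ Gal(L/ℚ)) (x : ClassP p L) :
    (∑ σ : Gal(L/ℚ), β.coeff σ • σ • x).toClassGroup = groupRingPow x.toClassGroup β := by
  rw [toClassGroup_sum, groupRingPow_eq_prod]
  rfl

variable (p L) in
theorem card_classP_eq_pow : ∃ j, Nat.card (ClassP p L) = p ^ j :=
  IsPGroup.exists_card_eq (G := CommGroup.primaryComponent (ClassGroup (𝓞 L)) p)
    CommGroup.primaryComponent.isPGroup

theorem ClassP.pow_smul_eq_zero {m : ℕ} (hm : Nat.card (ClassP p L) < p ^ m) (x : ClassP p L) :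
    p ^ m • x = 0 := by
  obtain ⟨j, hj⟩ := card_classP_eq_pow p L
  have h1 : j < m := (Nat.pow_lt_pow_iff_right (Fact.out : p.Prime).one_lt).1 (hj ▸ hm)
  have h2 : Nat.card (ClassP p L) • x = 0 := card_nsmul_eq_zero'
  rw [hj] at h2
  rw [← Nat.sub_add_cancel h1.le, pow_add, mul_smul, h2, smul_zero]

variable (p L) in
theorem card_div_mul_card : Nat.card (ClassGroup (𝓞 L)) / Nat.card (ClassP p L) *
    Nat.card (ClassP p L) = Nat.card (ClassGroup (𝓞 L)) :=
  Nat.div_mul_cancel (CommGroup.primaryComponent (ClassGroup (𝓞 L)) p).card_subgroup_dvd_card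

theorem exists_toClassGroup_eq_pow (c : ClassGroup (𝓞 L)) : ∃ x : ClassP p L,
    x.toClassGroup = c ^ (Nat.card (ClassGroup (𝓞 L)) / Nat.card (ClassP p L)) := by
  obtain ⟨j, hj⟩ := card_classP_eq_pow p L
  refine ⟨Additive.ofMul ⟨c ^ (Nat.card (ClassGroup (𝓞 L)) / Nat.card (ClassP p L)), j, ?_⟩, rfl⟩
  rw [← pow_mul, ← hj, card_div_mul_card, pow_card_eq_one']

variable (p L) in
/-- `Cl(L) / A` has no element of order `p`. -/
theorem not_dvd_card_div :
    ¬ p ∣ Nat.card (ClassGroup (𝓞 L)) / Nat.card (ClassP p L) := by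
  set A := CommGroup.primaryComponent (ClassGroup (𝓞 L)) p
  have h1 : Nat.card (ClassGroup (𝓞 L)) / Nat.card (ClassP p L) =
      Nat.card (ClassGroup (𝓞 L) ⧸ A) := by
    refine Nat.div_eq_of_eq_mul_left Nat.card_pos ?_
    exact A.card_eq_card_quotient_mul_card_subgroup
  rw [h1]
  intro h
  obtain ⟨q, hq⟩ := exists_prime_orderOf_dvd_card' p h
  obtain ⟨c, rfl⟩ := QuotientGroup.mk_surjective q
  have h2 : c ^ p ∈ A := by
    rw [← QuotientGroup.eq_one_iff, QuotientGroup.mk_pow, ← hq, pow_orderOf_eq_one]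
  obtain ⟨j, hj⟩ := h2
  have h3 : c ∈ A := ⟨j + 1, by rw [pow_succ', pow_mul, hj]⟩
  rw [(QuotientGroup.eq_one_iff c).2 h3, orderOf_one] at hq
  exact (Fact.out : p.Prime).one_lt.ne hq

end ClassGroupPart

/-! ### Classes modulo `p ^ k`-th powers -/

section PowQuot

variable {p : ℕ} [Fact p.Prime] {L : Type*} [Field L] [NumberField L] {k : ℕ}

theorem PowQuot.mk_mul (x y : Lˣ) :
    PowQuot.mk p k (x * y) = PowQuot.mk p k x + PowQuot.mk p k y := rfl

theorem PowQuot.mk_one : PowQuot.mk p k (1 : Lˣ) = 0 := rfl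

theorem PowQuot.mk_pow (n : ℕ) (x : Lˣ) : PowQuot.mk p k (x ^ n) = n • PowQuot.mk p k x := rfl

theorem PowQuot.mk_div (x y : Lˣ) :
    PowQuot.mk p k (x / y) = PowQuot.mk p k x - PowQuot.mk p k y := rfl

theorem PowQuot.mk_prod {ι : Type*} (s : Finset ι) (x : ι → Lˣ) :
    PowQuot.mk p k (∏ i ∈ s, x i) = ∑ i ∈ s, PowQuot.mk p k (x i) := by
  classical
  induction s using Finset.induction_on with
  | empty => rfl
  | insert i s hi h => rw [Finset.sum_insert hi, Finset.prod_insert hi, mk_mul, h]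

theorem PowQuot.mk_groupRingPow (x : Lˣ) (β : MonoidAlgebra ℤ Gal(L/ℚ)) :
    PowQuot.mk p k (groupRingPow x β) = ∑ σ : Gal(L/ℚ), β.coeff σ • σ • PowQuot.mk p k x := by
  rw [groupRingPow_eq_prod, mk_prod]
  rfl

theorem PowQuot.mk_eq_zero_iff {x : Lˣ} : PowQuot.mk p k x = 0 ↔ ∃ y : Lˣ, y ^ p ^ k = x :=
  QuotientGroup.eq_one_iff x

theorem PowQuot.pow_smul_eq_zero {m : ℕ} (hm : k ≤ m) (x : PowQuot p L k) : p ^ m • x = 0 := by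
  obtain ⟨α, rfl⟩ := PowQuot.mk_surjective p L k x
  rw [← mk_pow, mk_eq_zero_iff]
  exact ⟨α ^ p ^ (m - k), by rw [← pow_mul, ← pow_add, Nat.sub_add_cancel hm]⟩

variable [IsCyclotomicExtension {p} ℚ L] {ψ : Gal(L/ℚ) →* ℤ_[p]ˣ}

/-- The `p`-th roots of unity have trivial `ψ`-component unless `ψ = ω`. -/
theorem psiProj_root_eq_zero (hω : ¬ IsTeichmuller p L ψ) {ξ : Lˣ} (hξ : ξ ^ p = 1) :
    psiProj ψ _ (PowQuot.mk p k ξ) = 0 := by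
  have hζ := IsCyclotomicExtension.zeta_spec p ℚ L
  simp only [IsTeichmuller, not_forall] at hω
  obtain ⟨σ, η, hη, h⟩ := hω
  set s := (IsCyclotomicExtension.Rat.galEquivZMod p L σ).val.val with hs
  have hσ : ∀ ξ : L, ξ ^ p = 1 → σ ξ = ξ ^ s := fun ξ hξ =>
    IsCyclotomicExtension.Rat.galEquivZMod_apply_of_pow_eq p L σ hξ
  -- `ψ(σ) - s` is a unit that kills the `ψ`-component
  have hu : IsUnit (((ψ σ : ℤ_[p]ˣ) : ℤ_[p]) - (s : ℤ_[p])) := by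
    by_contra hnu
    have h0 : PadicInt.toZMod (((ψ σ : ℤ_[p]ˣ) : ℤ_[p]) - (s : ℤ_[p])) = 0 := by
      rw [← RingHom.mem_ker, PadicInt.ker_toZMod]
      exact (IsLocalRing.mem_maximalIdeal _).2 hnu
    rw [map_sub, map_natCast, sub_eq_zero] at h0
    refine h ?_
    rw [h0, hσ η hη, hs, ZMod.natCast_zmod_val]
  have h1 : σ • PowQuot.mk p k ξ = s • PowQuot.mk p k ξ := by
    rw [PowQuot.smul_mk, ← PowQuot.mk_pow]
    congr 1
    apply Units.ext
    rw [Units.val_pow_eq_pow_val]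
    exact hσ ξ (by rw [← Units.val_pow_eq_pow_val, hξ, Units.val_one])
  have h2 := psiProj_smul ψ σ (PowQuot.mk p k ξ)
  rw [h1, map_nsmul, ← Nat.cast_smul_eq_nsmul ℤ_[p], eq_comm, ← sub_eq_zero, ← sub_smul] at h2
  exact (hu.smul_eq_zero).1 h2

/-- Units have trivial `ψ`-component for odd `ψ ≠ ω`. -/
theorem psiProj_unit_eq_zero (hp : 5 ≤ p) (hodd : ψ (sigmaNegOne p L) = -1)
    (hω : ¬ IsTeichmuller p L ψ) {u : Lˣ} (hu : toPrincipalIdeal (𝓞 L) L u = 1) :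
    psiProj ψ _ (PowQuot.mk p k u) = 0 := by
  have h1 := psiProj_root_eq_zero (k := k) hω (unit_div_conj_sq_pow hp hu)
  rw [PowQuot.mk_pow, PowQuot.mk_div, ← PowQuot.smul_mk, map_nsmul, map_sub, psiProj_smul, hodd,
    Units.val_neg, Units.val_one, neg_smul, one_smul, sub_neg_eq_add, ← two_nsmul, smul_smul] at h1
  refine eq_zero_of_nsmul_eq_zero (p := p) (PowQuot.pow_smul_eq_zero le_rfl _) ?_ h1
  exact fun h => absurd (Nat.le_of_dvd (by norm_num) h) (by norm_num; omega)

end PowQuot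

section Values

variable {p : ℕ} [Fact p.Prime] {L : Type*} [Field L] [NumberField L]
  [IsCyclotomicExtension {p} ℚ L]

/-! ### Homomorphisms in `𝒲` and the ideals they generate -/

theorem coe_groupRingPow (I : idealsPrimeTo p L) (β : MonoidAlgebra ℤ Gal(L/ℚ)) :
    ((groupRingPow I β : idealsPrimeTo p L) : (FractionalIdeal (𝓞 L)⁰ L)ˣ) =
      groupRingPow (I : (FractionalIdeal (𝓞 L)⁰ L)ˣ) β :=
  map_groupRingPow (idealsPrimeTo p L).subtype (fun _ _ => rfl) I β

theorem toPrincipalIdeal_groupRingPow (α : Lˣ) (β : MonoidAlgebra ℤ Gal(L/ℚ)) :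
    toPrincipalIdeal (𝓞 L) L (groupRingPow α β) = groupRingPow (toPrincipalIdeal (𝓞 L) L α) β :=
  map_groupRingPow _ (fun σ x => (galois_smul_principal σ x).symm) α β

theorem mk_groupRingPow (I : (FractionalIdeal (𝓞 L)⁰ L)ˣ) (β : MonoidAlgebra ℤ Gal(L/ℚ)) :
    ClassGroup.mk L (groupRingPow I β) = groupRingPow (ClassGroup.mk L I) β :=
  map_groupRingPow (ClassGroup.mk L) (fun σ x => (galois_smul_mk σ x).symm) I β

/-- The value `f(I)` generates the ideal `I ^ β(f)`. -/
theorem toPrincipalIdeal_of_hasBeta {f : idealsPrimeTo p L →* Lˣ}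
    {β : MonoidAlgebra ℤ Gal(L/ℚ)} (hf : HasBeta f β) (I : idealsPrimeTo p L) :
    toPrincipalIdeal (𝓞 L) L (f I) = groupRingPow (I : (FractionalIdeal (𝓞 L)⁰ L)ˣ) β := by
  obtain ⟨h, h0, α, hα, e⟩ := exists_pow_eq_principal I
  apply fractionalIdeal_pow_injective h0
  have h1 : (⟨toPrincipalIdeal (𝓞 L) L α, principal_mem_idealsPrimeTo p L hα⟩ :
      idealsPrimeTo p L) = I ^ h := Subtype.ext e
  have h2 := hf α hα
  rw [h1, map_pow] at h2
  rw [← map_pow, h2, ← groupRingPow_pow, ← e]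
  exact toPrincipalIdeal_groupRingPow α β

/-- For odd `β`, there is `f ∈ 𝒲⁻` with `β(f) = β` as soon as each `I ^ β` has a generator `y` in
`U` with `σ_{-1} y = y⁻¹`: the uniqueness of this generator makes it a homomorphism of
`ℤ[Gal(L/ℚ)]`-modules in `I`. -/
theorem exists_calWMinus_hasBeta (hp : 5 ≤ p) {β : MonoidAlgebra ℤ Gal(L/ℚ)}
    (hβ : MonoidAlgebra.single (sigmaNegOne p L) 1 * β = -β)
    (h : ∀ I : idealsPrimeTo p L, ∃ y ∈ unitsU p L, sigmaNegOne p L • y = y⁻¹ ∧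
      toPrincipalIdeal (𝓞 L) L y = groupRingPow (I : (FractionalIdeal (𝓞 L)⁰ L)ˣ) β) :
    ∃ f ∈ calWMinus p L, HasBeta f β := by
  choose f hU hanti hf using h
  have hconj : ∀ (σ : Gal(L/ℚ)) {y : Lˣ}, sigmaNegOne p L • y = y⁻¹ →
      sigmaNegOne p L • σ • y = (σ • y)⁻¹ := fun σ y hy => by
    rw [← mul_smul, galois_mul_comm p, mul_smul, hy, smul_inv']
  refine ⟨⟨⟨f, ?_⟩, ?_⟩, ⟨⟨?_, hU, β, ?_⟩, hanti⟩, ?_⟩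
  · refine eq_of_toPrincipalIdeal_eq hp (hU 1) (principalUnits p L 1).one_mem (hanti 1) ?_ ?_
    · rw [smul_one, inv_one]
    · rw [hf, map_one, ← coe_groupRingPow]
      have h1 : groupRingPow (1 : idealsPrimeTo p L) β = 1 := by
        simp [groupRingPow]
      rw [h1, Subgroup.coe_one]
  · intro I J
    refine eq_of_toPrincipalIdeal_eq hp (hU _)
      ((principalUnits p L 1).mul_mem (hU I) (hU J)) (hanti _) ?_ ?_
    · simp only [smul_mul', hanti, mul_inv]
    · rw [map_mul, hf, hf, hf, Subgroup.coe_mul, groupRingPow_mul]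
  · intro σ I
    refine eq_of_toPrincipalIdeal_eq hp (hU _) (smul_mem_principalUnits 1 σ _ (hU I)) (hanti _)
      (hconj σ (hanti I)) ?_
    change toPrincipalIdeal (𝓞 L) L (f (σ • I)) = toPrincipalIdeal (𝓞 L) L (σ • f I)
    rw [← galois_smul_principal, hf, hf, smul_groupRingPow (galois_mul_comm p)]
    rfl
  all_goals
    intro α hα
    refine eq_of_toPrincipalIdeal_eq hp (hU _)
      (groupRingPow_mem (smul_mem_principalUnits 1) (mem_unitsU_iff.1 hα) β) (hanti _) ?_ ?_
    · change sigmaNegOne p L • groupRingPow α β = (groupRingPow α β)⁻¹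
      rw [← groupRingPow_single_one_mul, hβ, groupRingPow_neg]
    · exact (hf _).trans (toPrincipalIdeal_groupRingPow α β).symm

theorem calWMinus_unique (hp : 5 ≤ p) {β : MonoidAlgebra ℤ Gal(L/ℚ)}
    {f g : idealsPrimeTo p L →* Lˣ} (hf : f ∈ calWMinus p L) (hfβ : HasBeta f β)
    (hg : g ∈ calWMinus p L) (hgβ : HasBeta g β) : f = g := by
  ext1 I
  refine eq_of_toPrincipalIdeal_eq hp (hf.1.2.1 I) (hg.1.2.1 I) (hf.2 I) (hg.2 I) ?_
  rw [toPrincipalIdeal_of_hasBeta hfβ, toPrincipalIdeal_of_hasBeta hgβ]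

/-- If `J` is prime to `p`, `J = (γ)` and `σ_{-1} J = J⁻¹`, then `J ^ 2` is generated by some
`y ∈ U` with `σ_{-1} y = y⁻¹`, namely by `γ / σ_{-1} γ` times a `p`-th root of unity. -/
theorem exists_anti_generator (J : idealsPrimeTo p L)
    (hJ : sigmaNegOne p L • (J : (FractionalIdeal (𝓞 L)⁰ L)ˣ) =
      (J : (FractionalIdeal (𝓞 L)⁰ L)ˣ)⁻¹)
    (hmk : ClassGroup.mk L (J : (FractionalIdeal (𝓞 L)⁰ L)ˣ) = 1) :
    ∃ y ∈ unitsU p L, sigmaNegOne p L • y = y⁻¹ ∧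
      toPrincipalIdeal (𝓞 L) L y = (J : (FractionalIdeal (𝓞 L)⁰ L)ˣ) ^ 2 := by
  obtain ⟨γ, hγ⟩ := mk_eq_one_iff_exists.1 hmk
  obtain ⟨ξ, hξ, hU⟩ := exists_root_mul_mem_principalUnits_one
    (div_smul_mem_principalUnits (by rw [hγ]; exact J.2) (sigmaNegOne p L))
  refine ⟨_, hU, ?_, ?_⟩
  · have h1 : sigmaNegOne p L • ξ = ξ⁻¹ := by
      apply Units.ext
      rw [Units.val_inv_eq_inv_val]
      exact sigmaNegOne_apply_root p L (by rw [← Units.val_pow_eq_pow_val, hξ, Units.val_one])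
    rw [smul_mul', smul_div', ← mul_smul, sigmaNegOne_mul_self, one_smul, h1, mul_inv, inv_div]
  · have h1 : toPrincipalIdeal (𝓞 L) L ξ = 1 := by
      apply fractionalIdeal_pow_injective (Fact.out : p.Prime).ne_zero
      rw [← map_pow, hξ, map_one, one_pow]
    rw [map_mul, h1, one_mul, map_div, ← galois_smul_principal, hγ, hJ, div_inv_eq_mul, sq]

/-! ### The exponent of `A(ψ)` -/

variable {ψ : Gal(L/ℚ) →* ℤ_[p]ˣ}

variable (ψ) in
theorem exponent_classPsi : AddMonoid.exponent (classPsi ψ) = p ^ kPsi ψ := by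
  obtain ⟨N, hN⟩ := ClassP.exists_pow_smul p L
  have h1 : AddMonoid.exponent (classPsi ψ) ∣ p ^ N :=
    AddMonoid.exponent_dvd_of_forall_nsmul_eq_zero fun x => Subtype.ext (hN x)
  obtain ⟨j, -, hj⟩ := (Nat.dvd_prime_pow Fact.out).1 h1
  rw [kPsi, hj, padicValNat.prime_pow]

theorem pow_kPsi_smul {x : ClassP p L} (hx : x ∈ classPsi ψ) : p ^ kPsi ψ • x = 0 := by
  have h := AddMonoid.exponent_nsmul_eq_zero (⟨x, hx⟩ : classPsi ψ)
  rw [exponent_classPsi] at h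
  exact congrArg Subtype.val h

theorem kPsi_le_of_forall {j : ℕ} (h : ∀ x ∈ classPsi ψ, p ^ j • x = 0) : kPsi ψ ≤ j := by
  have h1 : AddMonoid.exponent (classPsi ψ) ∣ p ^ j :=
    AddMonoid.exponent_dvd_of_forall_nsmul_eq_zero fun x => Subtype.ext (h x x.2)
  rw [exponent_classPsi] at h1
  exact (Nat.pow_dvd_pow_iff_le_right (Fact.out : p.Prime).one_lt).1 h1

theorem pow_kPsi_dvd {z : ℤ_[p]} (h : ∀ x ∈ classPsi ψ, z • x = 0) :
    (p : ℤ_[p]) ^ kPsi ψ ∣ z := by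
  by_cases hz : z = 0
  · exact hz ▸ dvd_zero _
  · have h1 := PadicInt.unitCoeff_spec hz
    rw [h1]
    refine Dvd.dvd.mul_left (pow_dvd_pow _ (kPsi_le_of_forall fun x hx => ?_)) _
    have h2 := h x hx
    rw [h1, mul_smul, (PadicInt.unitCoeff hz).isUnit.smul_eq_zero, ← Nat.cast_pow,
      Nat.cast_smul_eq_nsmul] at h2
    exact h2

/-- For `g ∈ 𝒲`, `β(g)` kills the class group, so that `p ^ k(ψ)` divides `ψ(β(g))`. -/
theorem pow_kPsi_dvd_psi_beta {g : idealsPrimeTo p L →* Lˣ} {β : MonoidAlgebra ℤ Gal(L/ℚ)}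
    (hg : HasBeta g β) : (p : ℤ_[p]) ^ kPsi ψ ∣
      ∑ σ : Gal(L/ℚ), (β.coeff σ : ℤ_[p]) * ((ψ σ : ℤ_[p]ˣ) : ℤ_[p]) := by
  refine pow_kPsi_dvd fun x hx => ?_
  obtain ⟨I, hI⟩ := exists_idealsPrimeTo_mk_eq (p := p) x.toClassGroup
  have h1 : ∑ σ : Gal(L/ℚ), β.coeff σ • σ • x = 0 := by
    apply ClassP.toClassGroup_injective
    rw [ClassP.toClassGroup_sum_zsmul, ← hI, ← mk_groupRingPow,
      ← toPrincipalIdeal_of_hasBeta hg, ClassP.toClassGroup_zero]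
    exact mk_eq_one_iff_exists.2 ⟨_, rfl⟩
  rw [← h1, Finset.sum_smul]
  refine Finset.sum_congr rfl fun σ _ => ?_
  rw [smul_of_mem_psiPart ψ hx, mul_smul, Int.cast_smul_eq_zsmul]

variable {m : ℕ} {e : MonoidAlgebra ℤ Gal(L/ℚ)}

theorem kPsi_le (hmA : Nat.card (ClassP p L) < p ^ m) : kPsi ψ ≤ m :=
  kPsi_le_of_forall fun x _ => ClassP.pow_smul_eq_zero hmA x

/-- The divisor of `x ^ e` is a `p ^ k(ψ)`-th power for `x ∈ W`. -/
theorem exists_ideal_pow_eq (hmA : Nat.card (ClassP p L) < p ^ m) (he : IsLiftEIdem ψ m e)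
    {x : Lˣ} (hx : x ∈ groupW p L) : ∃ J : idealsPrimeTo p L,
      toPrincipalIdeal (𝓞 L) L (groupRingPow x e) =
        (J : (FractionalIdeal (𝓞 L)⁰ L)ˣ) ^ p ^ kPsi ψ := by
  induction hx using Subgroup.closure_induction with
  | mem x hx =>
    obtain ⟨g, ⟨hg, -, β, hβ⟩, I, rfl⟩ := hx
    have h1 : ∀ τ, ∃ q : ℤ, (β * e).coeff τ = q * (p ^ kPsi ψ : ℕ) := fun τ => by
      have h2 := (dvd_sub_left ((pow_kPsi_dvd_psi_beta (ψ := ψ) hβ).mul_right _)).1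
        ((pow_dvd_pow _ (kPsi_le hmA)).trans (coeff_mul_lift_dvd ψ he.2 β τ))
      rw [PadicInt.pow_p_dvd_int_iff] at h2
      obtain ⟨q, hq⟩ := h2
      exact ⟨q, by rw [hq]; push_cast; ring⟩
    choose q hq using h1
    refine ⟨∏ σ, (σ • I) ^ q σ, ?_⟩
    rw [← map_groupRingPow g hg, toPrincipalIdeal_of_hasBeta hβ, coe_groupRingPow,
      ← groupRingPow_exponent_mul, groupRingPow_eq_prod, Subgroup.val_finsetProd,
      ← Finset.prod_pow]
    refine Finset.prod_congr rfl fun σ _ => ?_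
    rw [hq, zpow_mul, zpow_natCast]
    rfl
  | one => exact ⟨1, by simp [groupRingPow]⟩
  | mul x y _ _ hx hy =>
    obtain ⟨J, hJ⟩ := hx
    obtain ⟨K, hK⟩ := hy
    exact ⟨J * K, by rw [groupRingPow_mul, map_mul, hJ, hK, Subgroup.coe_mul, mul_pow]⟩
  | inv x _ hx =>
    obtain ⟨J, hJ⟩ := hx
    refine ⟨J⁻¹, ?_⟩
    have h1 : groupRingPow x⁻¹ e = (groupRingPow x e)⁻¹ := by simp [groupRingPow]
    rw [h1, map_inv, hJ, Subgroup.coe_inv, inv_pow]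

/-! ### The homomorphism `f_ψ` -/

theorem single_mul_betaPsi (he : IsLiftEIdem ψ m e) :
    MonoidAlgebra.single (sigmaNegOne p L) 1 * betaPsi ψ e = -betaPsi ψ e := by
  rw [betaPsi, mul_smul_comm, he.1, smul_neg]

theorem sum_zsmul_eq_self (hmA : Nat.card (ClassP p L) < p ^ m) (he : IsLiftEIdem ψ m e)
    {x : ClassP p L} (hx : x ∈ classPsi ψ) : ∑ σ : Gal(L/ℚ), e.coeff σ • σ • x = x := by
  rw [← psiProj_eq_sum_int ψ he.2 (ClassP.pow_smul_eq_zero hmA x)]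
  exact psiProj_of_mem ψ (card_galois p L) hx

theorem exists_isFPsi (hp : 5 ≤ p) (hmA : Nat.card (ClassP p L) < p ^ m)
    (he : IsLiftEIdem ψ m e) : ∃ f : idealsPrimeTo p L →* Lˣ, IsFPsi ψ e f := by
  refine exists_calWMinus_hasBeta hp (single_mul_betaPsi he) fun I => ?_
  set n := Nat.card (ClassGroup (𝓞 L)) / Nat.card (ClassP p L) with hn
  set J : idealsPrimeTo p L := groupRingPow I e ^ (n * p ^ kPsi ψ) with hJ
  have hJ' : (J : (FractionalIdeal (𝓞 L)⁰ L)ˣ) =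
      groupRingPow (I : (FractionalIdeal (𝓞 L)⁰ L)ˣ) e ^ (n * p ^ kPsi ψ) := by
    rw [hJ, Subgroup.coe_pow, coe_groupRingPow]
  obtain ⟨y, hy, hy1, hy2⟩ := exists_anti_generator J (by
    rw [hJ', smul_pow', ← groupRingPow_single_one_mul, he.1, groupRingPow_neg, inv_pow]) (by
    -- the class of `I ^ (n e)` lies in `A(ψ)`
    obtain ⟨x, hx⟩ := exists_toClassGroup_eq_pow (p := p)
      (ClassGroup.mk L (I : (FractionalIdeal (𝓞 L)⁰ L)ˣ))
    rw [← hn] at hx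
    rw [hJ', map_pow, mk_groupRingPow, pow_mul, ← groupRingPow_pow, ← hx,
      ← ClassP.toClassGroup_sum_zsmul, ← psiProj_eq_sum_int ψ he.2 (ClassP.pow_smul_eq_zero hmA x),
      ← ClassP.toClassGroup_nsmul, pow_kPsi_smul, ClassP.toClassGroup_zero]
    exact ⟨x, trivial, rfl⟩)
  refine ⟨y, hy, hy1, hy2.trans ?_⟩
  rw [hJ', betaPsi, groupRingPow_nsmul, ← pow_mul]
  congr 1
  ring

theorem betaPsi_eq_nsmul : betaPsi ψ e = p ^ kPsi ψ •
    (2 * (Nat.card (ClassGroup (𝓞 L)) / Nat.card (ClassP p L))) • e := by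
  rw [betaPsi, smul_smul, mul_comm]

variable {f : idealsPrimeTo p L →* Lˣ}

/-- On principal ideals prime to `p`, whether or not they have a generator in `U`, the values of
`f_ψ` are `p ^ k(ψ)`-th powers. If `k(ψ) ≥ 1` this is because `α ^ β(f_ψ)` lies in `U` for each `α`
prime to `p`: it is a `p`-th power of some `δ ^ 2` with `σ_{-1} δ = δ⁻¹`. -/
theorem powQuot_mk_isFPsi_principal (hp : 5 ≤ p) (he : IsLiftEIdem ψ m e) (hf : IsFPsi ψ e f)
    {α : Lˣ} {I : idealsPrimeTo p L}
    (hI : toPrincipalIdeal (𝓞 L) L α = (I : (FractionalIdeal (𝓞 L)⁰ L)ˣ)) :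
    PowQuot.mk p (kPsi ψ) (f I) = 0 := by
  rw [PowQuot.mk_eq_zero_iff]
  rcases Nat.eq_zero_or_pos (kPsi ψ) with h0 | h0
  · exact ⟨f I, by rw [h0, pow_zero, pow_one]⟩
  set n := Nat.card (ClassGroup (𝓞 L)) / Nat.card (ClassP p L) with hn
  set δ := groupRingPow α e with hδ
  have hδ1 : sigmaNegOne p L • δ = δ⁻¹ := by
    rw [hδ, ← groupRingPow_single_one_mul, he.1, groupRingPow_neg]
  have hδ2 : δ ^ 2 ∈ principalUnits p L 0 := by
    have h1 := div_smul_mem_principalUnits (p := p) (α := δ) (by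
      rw [hδ, toPrincipalIdeal_groupRingPow, hI, ← coe_groupRingPow]
      exact Subtype.prop _) (sigmaNegOne p L)
    rwa [hδ1, div_inv_eq_mul, ← sq] at h1
  have hβ : groupRingPow α (betaPsi ψ e) = ((δ ^ 2) ^ p) ^ (n * p ^ (kPsi ψ - 1)) := by
    rw [betaPsi, groupRingPow_nsmul, ← hδ, ← pow_mul, ← pow_mul, ← hn]
    congr 1
    obtain ⟨k, hk⟩ : ∃ k, kPsi ψ = k + 1 := ⟨kPsi ψ - 1, by omega⟩
    rw [hk, Nat.add_sub_cancel]
    ring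
  have hfα : f I = groupRingPow α (betaPsi ψ e) := by
    refine eq_of_toPrincipalIdeal_eq hp (hf.1.1.2.1 I) ?_ (hf.1.2 I) ?_ ?_
    · rw [hβ]
      exact (principalUnits p L 1).pow_mem (pow_mem_principalUnits_one hδ2) _
    · rw [← groupRingPow_single_one_mul, single_mul_betaPsi he, groupRingPow_neg]
    · rw [toPrincipalIdeal_of_hasBeta hf.2, toPrincipalIdeal_groupRingPow, hI]
  exact ⟨groupRingPow α ((2 * n) • e), by rw [hfα, betaPsi_eq_nsmul, groupRingPow_nsmul _ (p ^ _)]⟩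

/-- The map `A → L* / (L*) ^ (p ^ k(ψ))` induced by `f_ψ`. -/
theorem exists_inducedHom (hp : 5 ≤ p) (he : IsLiftEIdem ψ m e) (hf : IsFPsi ψ e f) :
    ∃ F : ClassP p L →+ PowQuot p L (kPsi ψ),
      (∀ (I : idealsPrimeTo p L) (x : ClassP p L),
        x.toClassGroup = ClassGroup.mk L (I : (FractionalIdeal (𝓞 L)⁰ L)ˣ) →
          F x = PowQuot.mk p (kPsi ψ) (f I)) ∧
      ∀ (σ : Gal(L/ℚ)) (x : ClassP p L), F (σ • x) = σ • F x := by
  have hwd : ∀ I J : idealsPrimeTo p L,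
      ClassGroup.mk L (I : (FractionalIdeal (𝓞 L)⁰ L)ˣ) =
        ClassGroup.mk L (J : (FractionalIdeal (𝓞 L)⁰ L)ˣ) →
      PowQuot.mk p (kPsi ψ) (f I) = PowQuot.mk p (kPsi ψ) (f J) := by
    intro I J h
    obtain ⟨α, hα⟩ := mk_eq_one_iff_exists.1 (show ClassGroup.mk L
      ((I / J : idealsPrimeTo p L) : (FractionalIdeal (𝓞 L)⁰ L)ˣ) = 1 by
        rw [Subgroup.coe_div, map_div, h, div_self'])
    have h1 := powQuot_mk_isFPsi_principal hp he hf hα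
    rwa [map_div, PowQuot.mk_div, sub_eq_zero] at h1
  choose r hr using fun x : ClassP p L => exists_idealsPrimeTo_mk_eq (p := p) x.toClassGroup
  have hF : ∀ (I : idealsPrimeTo p L) (x : ClassP p L),
      x.toClassGroup = ClassGroup.mk L (I : (FractionalIdeal (𝓞 L)⁰ L)ˣ) →
        PowQuot.mk p (kPsi ψ) (f (r x)) = PowQuot.mk p (kPsi ψ) (f I) :=
    fun I x h => hwd _ _ ((hr x).trans h)
  refine ⟨⟨⟨fun x => PowQuot.mk p (kPsi ψ) (f (r x)), ?_⟩, ?_⟩, hF, ?_⟩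
  · rw [hF 1 0 (by rw [ClassP.toClassGroup_zero, Subgroup.coe_one, map_one]), map_one,
      PowQuot.mk_one]
  · intro x y
    change PowQuot.mk p (kPsi ψ) (f (r (x + y))) = _
    rw [hF (r x * r y) (x + y) (by rw [ClassP.toClassGroup_add, Subgroup.coe_mul, map_mul, hr, hr]),
      map_mul, PowQuot.mk_mul]
  · intro σ x
    change PowQuot.mk p (kPsi ψ) (f (r (σ • x))) = σ • PowQuot.mk p (kPsi ψ) (f (r x))
    rw [PowQuot.smul_mk, ← hf.1.1.1]
    refine hF _ _ ?_
    rw [ClassP.toClassGroup_smul, ← hr, galois_smul_mk]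
    rfl

theorem not_dvd_two_mul_card_div (hp : 5 ≤ p) :
    ¬ p ∣ 2 * (Nat.card (ClassGroup (𝓞 L)) / Nat.card (ClassP p L)) := by
  intro h
  rcases (Fact.out : p.Prime).dvd_mul.1 h with h | h
  · exact absurd (Nat.le_of_dvd (by norm_num) h) (by omega)
  · exact not_dvd_card_div p L h

/-- Injectivity on `A(ψ)` of the map induced by `f_ψ`. -/
theorem isFPsi_injective (hp : 5 ≤ p) (hmA : Nat.card (ClassP p L) < p ^ m)
    (he : IsLiftEIdem ψ m e) (hf : IsFPsi ψ e f) {I : idealsPrimeTo p L} {x : ClassP p L}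
    (hx : x ∈ classPsi ψ) (hI : x.toClassGroup = ClassGroup.mk L I.1)
    (h : PowQuot.mk p (kPsi ψ) (f I) = 0) : x = 0 := by
  obtain ⟨γ, hγ⟩ := PowQuot.mk_eq_zero_iff.1 h
  -- `(γ) ^ (p ^ k) = I ^ (2 n p ^ k e)`
  have h1 := toPrincipalIdeal_of_hasBeta hf.2 I
  rw [← hγ, map_pow, betaPsi_eq_nsmul, groupRingPow_nsmul] at h1
  have h2 := fractionalIdeal_pow_injective (pow_ne_zero _ (Fact.out : p.Prime).ne_zero) h1
  have h3 := mk_eq_one_iff_exists.2 ⟨γ, h2⟩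
  rw [mk_groupRingPow, groupRingPow_nsmul, ← hI, ← ClassP.toClassGroup_sum_zsmul,
    sum_zsmul_eq_self hmA he hx, ← ClassP.toClassGroup_nsmul] at h3
  exact eq_zero_of_nsmul_eq_zero (ClassP.pow_smul_eq_zero hmA x) (not_dvd_two_mul_card_div hp)
    (ClassP.toClassGroup_injective p h3)

/-- Surjectivity of the map `F` induced by `f_ψ`, on the `ψ`-components. -/
theorem exists_preimage (hp : 5 ≤ p) (hodd : ψ (sigmaNegOne p L) = -1)
    (hω : ¬ IsTeichmuller p L ψ) (hmA : Nat.card (ClassP p L) < p ^ m)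
    (he : IsLiftEIdem ψ m e) (hf : IsFPsi ψ e f) {F : ClassP p L →+ PowQuot p L (kPsi ψ)}
    (hF : ∀ (I : idealsPrimeTo p L) (x : ClassP p L),
        x.toClassGroup = ClassGroup.mk L (I : (FractionalIdeal (𝓞 L)⁰ L)ˣ) →
          F x = PowQuot.mk p (kPsi ψ) (f I))
    (hFσ : ∀ (σ : Gal(L/ℚ)) (x : ClassP p L), F (σ • x) = σ • F x)
    {w : PowQuot p L (kPsi ψ)} (hw : w ∈ psiPart ψ (groupWQuot p L (kPsi ψ))) :
    ∃ x ∈ classPsi ψ, F x = w := by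
  obtain ⟨y, ⟨x, hx, rfl⟩, rfl⟩ := (mem_psiPart ψ).1 hw
  change ∃ z ∈ classPsi ψ, F z = psiProj ψ _ (PowQuot.mk p (kPsi ψ) x)
  set w := psiProj ψ _ (PowQuot.mk p (kPsi ψ) x) with hwdef
  set n := Nat.card (ClassGroup (𝓞 L)) / Nat.card (ClassP p L) with hn
  have hE : ∀ z : PowQuot p L (kPsi ψ), psiProj ψ _ z = ∑ σ : Gal(L/ℚ), e.coeff σ • σ • z :=
    fun z => psiProj_eq_sum_int ψ he.2 (PowQuot.pow_smul_eq_zero (kPsi_le hmA) z)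
  obtain ⟨J, hJ⟩ := exists_ideal_pow_eq hmA he hx
  -- `f(J)` and `x ^ (2 n e ^ 2)` differ by a unit
  have hu : toPrincipalIdeal (𝓞 L) L
      (f J / groupRingPow (groupRingPow x e) ((2 * n) • e)) = 1 := by
    rw [map_div, toPrincipalIdeal_of_hasBeta hf.2, toPrincipalIdeal_groupRingPow, hJ,
      betaPsi_eq_nsmul, groupRingPow_nsmul, groupRingPow_pow, div_self']
  have h1 := psiProj_unit_eq_zero (k := kPsi ψ) hp hodd hω hu
  rw [PowQuot.mk_div, groupRingPow_nsmul, PowQuot.mk_pow, PowQuot.mk_groupRingPow, ← hE,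
    PowQuot.mk_groupRingPow, ← hE, map_sub, map_nsmul, psiProj_psiProj ψ (card_galois p L),
    psiProj_psiProj ψ (card_galois p L), sub_eq_zero, ← hwdef] at h1
  obtain ⟨v, hv⟩ := exists_toClassGroup_eq_pow (p := p)
    (ClassGroup.mk L (J : (FractionalIdeal (𝓞 L)⁰ L)ˣ))
  have h2 : F (psiProj ψ _ v) = (n * (2 * n)) • w := by
    rw [map_psiProj ψ he.2 F hFσ (ClassP.pow_smul_eq_zero hmA v),
      hF (J ^ n) v (by rw [hv, Subgroup.coe_pow, map_pow]), map_pow, PowQuot.mk_pow, map_nsmul, h1,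
      smul_smul]
  have hcop : IsCoprime ((n * (2 * n) : ℕ) : ℤ) ((p ^ kPsi ψ : ℕ) : ℤ) := by
    refine Nat.Coprime.isCoprime (Nat.Coprime.pow_right _ (Nat.Coprime.symm ?_))
    exact Nat.Coprime.mul_right
      ((Nat.Prime.coprime_iff_not_dvd Fact.out).2 (not_dvd_card_div p L))
      ((Nat.Prime.coprime_iff_not_dvd Fact.out).2 (not_dvd_two_mul_card_div hp))
  -- `n (2 n)` is invertible modulo `p ^ k(ψ)`
  obtain ⟨a, b, hab⟩ := hcop
  refine ⟨a • psiProj ψ _ v, (classPsi ψ).zsmul_mem ⟨v, trivial, rfl⟩ a, ?_⟩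
  calc F (a • psiProj ψ _ v)
    _ = a • ((n * (2 * n) : ℕ) : ℤ) • w + b • ((p ^ kPsi ψ : ℕ) : ℤ) • w := by
        rw [map_zsmul, h2, natCast_zsmul, natCast_zsmul, PowQuot.pow_smul_eq_zero le_rfl, smul_zero,
          add_zero]
    _ = w := by rw [smul_smul, smul_smul, ← add_smul, hab, one_smul]

end Values

end JacobiSums

theorem theorem3p3 (p : ℕ) [Fact p.Prime] (hp : 5 ≤ p)
    (L : Type*) [Field L] [NumberField L] [IsCyclotomicExtension {p} ℚ L]
    (ψ : Gal(L/ℚ) →* ℤ_[p]ˣ) (hodd : ψ (JacobiSums.sigmaNegOne p L) = -1)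
    (hω : ¬ JacobiSums.IsTeichmuller p L ψ)
    (m : ℕ) (hm : 1 ≤ m) (hmA : Nat.card (JacobiSums.ClassP p L) < p ^ m)
    (e : MonoidAlgebra ℤ Gal(L/ℚ)) (he : JacobiSums.IsLiftEIdem ψ m e) :
    AddMonoid.exponent (JacobiSums.classPsi ψ) = p ^ JacobiSums.kPsi ψ ∧
    (∃! f : JacobiSums.idealsPrimeTo p L →* Lˣ, JacobiSums.IsFPsi ψ e f) ∧
    ∀ f : JacobiSums.idealsPrimeTo p L →* Lˣ, JacobiSums.IsFPsi ψ e f →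
      ∃ Φ : JacobiSums.classPsi ψ ≃+
          JacobiSums.psiPart ψ (JacobiSums.groupWQuot p L (JacobiSums.kPsi ψ)),
        ∀ (I : JacobiSums.idealsPrimeTo p L) (x : JacobiSums.classPsi ψ),
          (x : JacobiSums.ClassP p L).toClassGroup =
              ClassGroup.mk L (I : (FractionalIdeal (𝓞 L)⁰ L)ˣ) →
            (Φ x : JacobiSums.PowQuot p L (JacobiSums.kPsi ψ)) =
              JacobiSums.PowQuot.mk p (JacobiSums.kPsi ψ) (f I) := by
  open JacobiSums in
  refine ⟨exponent_classPsi ψ, ?_, fun f hf => ?_⟩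
  · obtain ⟨f, hf⟩ := exists_isFPsi hp hmA he
    exact ⟨f, hf, fun g hg => calWMinus_unique hp hg.1 hg.2 hf.1 hf.2⟩
  · obtain ⟨F, hF, hFσ⟩ := exists_inducedHom hp he hf
    have hmem : ∀ x : classPsi ψ, F x ∈ psiPart ψ (groupWQuot p L (kPsi ψ)) := fun x => by
      obtain ⟨I, hI⟩ := exists_idealsPrimeTo_mk_eq (p := p) (x : ClassP p L).toClassGroup
      refine (mem_psiPart ψ).2 ⟨F x, ?_, ?_⟩
      · rw [hF I x hI.symm]
        exact ⟨f I, Subgroup.subset_closure ⟨f, hf.1.1, I, rfl⟩, rfl⟩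
      · rw [← map_psiProj ψ he.2 F hFσ (ClassP.pow_smul_eq_zero hmA _),
          psiProj_of_mem ψ (card_galois p L) x.2]
    refine ⟨AddEquiv.ofBijective ((F.comp (classPsi ψ).subtype).codRestrict _ hmem) ⟨?_, ?_⟩,
      fun I x hx => hF I x hx⟩
    · rw [injective_iff_map_eq_zero]
      intro x hx
      obtain ⟨I, hI⟩ := exists_idealsPrimeTo_mk_eq (p := p) (x : ClassP p L).toClassGroup
      refine Subtype.ext (isFPsi_injective hp hmA he hf x.2 hI.symm ?_)
      rw [← hF I x hI.symm]
      exact congrArg Subtype.val hx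
    · rintro ⟨w, hw⟩
      obtain ⟨x, hx, rfl⟩ := exists_preimage hp hodd hω hmA he hf hF hFσ hw
      exact ⟨⟨x, hx⟩, rfl⟩
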